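/- Let $\mathcal X$ be a locally compact, Hausdorff, second-countable single-object space with a $\sigma$-finite reference measure $dx$ without atoms. Let $T_{(k)}=\biguplus_{(t,\nu)}\{t\}\times\mathcal X^\nu$ (with $0\le t\le k$, $1\le \nu\le k-t+1$) be the space of trajectories $X=(t,x^{1:\nu})$ up to time $k$, with $\int\pi(X)\,dX=\sum_{(t,\nu)}\int\pi(t,x^{1:\nu})\,dx^{1:\nu}$. For a set of pairs $(u,X)$ the set integral is $\int f(\mathbf X)\,\delta\mathbf X=\sum_N\frac1{N!}\int f(\{x_1,\dots,x_N\})\,d(x_1,\dots,x_N)$, where integration over $x=(u,X)$ includes summation over the auxiliary variable $u$. Write $\delta_a[b]=1$ if $a=b$ and $0$ otherwise. **Prior.** Let $n=n_{k|k-1}$. The predicted density on finite subsets $\widetilde{\mathbf X}$ of $\{0,\dots,n\}\times T_{(k)}$ is the trajectory PMB $$\widetilde f^{\,p}_{k|k-1}(\widetilde{\mathbf Y})\prod_{i=1}^{n}\widetilde f^{\,i}_{k|k-1}(\widetilde{\mathbf X}^i),\qquad \widetilde{\mathbf Y}=\{(u,X)\in\widetilde{\mathbf X}:u=0\},\quad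 \widetilde{\mathbf X}^i=\{(u,X)\in\widetilde{\mathbf X}:u=i\},$$ where $\widetilde f^{\,p}_{k|k-1}(\widetilde{\mathbf Y})=e^{-\int\lambda_{k|k-1}}\prod_{(u,X)\in\widetilde{\mathbf Y}}\lambda_{k|k-1}(X)$ with an integrable intensity $\lambda_{k|k-1}\ge 0$, and $\widetilde f^{\,i}_{k|k-1}$ is the Bernoulli density with existence probability $r^i_{k|k-1}\in[0,1]$ and single-trajectory probability density $f^i_{k|k-1}$. **Measurements.** Let $\mathbf z_k=\{z_k^1,\dots,z_k^m\}\subset\mathbb R^{d_z}$ consist of $m=m_k$ distinct measurements. It is the union of a Poisson clutter set with intensity $\lambda^C_k=\gamma^C_k\mu^C_k$ (rate times probability density) and of sets generated by the trajectories, independently of each other and of the clutter, with set densities $$\ell_k(\mathbf w|X)=e^{-\gamma_k(X)}\prod_{z\in\mathbf w}\gamma_k(X)\ell_k(z|X),\quad \gamma_k(t,x^{1:\nu})=\gamma_k(x^\nu)\delta_k[t+\nu-1],\quad \ell_k(z|t,x^{1:\nu})=\ell_k(z|x^\nu)\delta_k[t+\nu-1],$$ where $\gamma_k\ge0$ and $\ell_k(\cdot|x)$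 is a probability density. Assume that $\lambda^C_k(z_k^j)>0$ for all $j$ and that the evidence (the predicted multi-object likelihood of $\mathbf z_k$) is finite. **Labels and association vector.** Let $n_{k|k}=n+m$. In the posterior the auxiliary variables take values in $\{0,\dots,n_{k|k}\}$: a trajectory with prior label $u\in\{1,\dots,n\}$ keeps its label; a trajectory with prior label $0$ keeps the label $0$ if it generates no measurement, and gets the label $n+j$ of the $j$-th new Bernoulli component if $j$ is the largest index of a measurement that it generates. The measurement-oriented association vector $\beta_k=(\beta_k^1,\dots,\beta_k^m)$ has $\beta_k^j=0$ if $z_k^j$ is clutter, and otherwise $\beta_k^j$ is the updated label of the trajectory that generated $z_k^j$; thus $\beta_k^j\in\{0,1,\dots,n,n+j,\dots,n+m\}$. **Claim.** The joint posterior law of $(\widetilde{\mathbf X}_k,\beta_k)$ given $\mathbf z_k$ (by Bayes' rule) has, with respect to the set integral over finite subsets of $\{0,\dots,n_{k|k}\}\times T_{(k)}$ and the sum over the vectors $\beta_k$ with $\beta_k^j\in\{0,\dots,n,n+j,\dots,n+m\}$ for all $j$, a density $\widetilde f_{k|k}(\widetilde{\mathbf X}_k,\beta_k)$ which is equal, up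 to a positive factor that does not depend on $(\widetilde{\mathbf X}_k,\beta_k)$, to $$\widetilde f^{\,p}_{k|k}(\widetilde{\mathbf Y}_k)\prod_{i=1}^{n}\Bigl[\underline f^i_{k|k-1}(\widetilde{\mathbf X}^i_k)\prod_{j=1}^{m}\underline s_k(\widetilde{\mathbf X}^i_k,\beta_k^j;z_k^j)\Bigr]\prod_{i=n+1}^{n+m}\Bigl[\overline f^i_{k|k-1}(\widetilde{\mathbf X}^i_k)\,\overline s_k(\widetilde{\mathbf X}^i_k,\beta_k^{i-n};z_k^{i-n})\prod_{j=1}^{i-n-1}\underline s_k(\widetilde{\mathbf X}^i_k,\beta_k^j;z_k^j)\Bigr],$$ where $\widetilde{\mathbf Y}_k$ and $\widetilde{\mathbf X}_k^i$ are the elements of $\widetilde{\mathbf X}_k$ with auxiliary variable $0$ and $i$, $\widetilde f^{\,p}_{k|k}$ is the Poisson density with intensity $\lambda_{k|k}(X)=e^{-\gamma_k(X)}\lambda_{k|k-1}(X)$, and $$\underline f^i_{k|k-1}(\widetilde{\mathbf X})=\begin{cases}r^i_{k|k-1}f^i_{k|k-1}(X)e^{-\gamma_k(X)}\delta_i[u]&\widetilde{\mathbf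 X}=\{(u,X)\}\\1-r^i_{k|k-1}&\widetilde{\mathbf X}=\emptyset\\0&\text{otherwise,}\end{cases}\qquad \overline f^i_{k|k-1}(\widetilde{\mathbf X})=\begin{cases}\lambda_{k|k-1}(X)e^{-\gamma_k(X)}\delta_i[u]&\widetilde{\mathbf X}=\{(u,X)\}\\1&\widetilde{\mathbf X}=\emptyset\\0&\text{otherwise,}\end{cases}$$ $$\underline s_k(\widetilde{\mathbf X}^i,\beta^j;z^j)=\begin{cases}\frac{\ell_k(z^j|X)\gamma_k(X)}{\lambda_k^C(z^j)}\delta_i[u]&\widetilde{\mathbf X}^i=\{(u,X)\},\ \beta^j=i\\1&\beta^j\ne i\\0&\text{otherwise,}\end{cases}\qquad \overline s_k(\widetilde{\mathbf X}^i,\beta^j;z^j)=\begin{cases}\frac{\ell_k(z^j|X)\gamma_k(X)}{\lambda_k^C(z^j)}\delta_i[u]&\widetilde{\mathbf X}^i=\{(u,X)\},\ \beta^j=i\\1&\widetilde{\mathbf X}^i=\emptyset,\ \beta^j\ne i\\0&\text{otherwise.}\end{cases}$$ -/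

import Mathlib

open MeasureTheory
open scoped ENNReal Nat

noncomputable section

namespace TrajectoryPMB

/-! ### Trajectories -/

/-- Pairs (start time `t`, length `ν`) of a trajectory up to time step `k`:
`0 ≤ t ≤ k` and `1 ≤ ν ≤ k - t + 1`. -/
def TrajIndex (k : ℕ) : Type :=
  {p : ℕ × ℕ // p.1 ≤ k ∧ 1 ≤ p.2 ∧ p.2 + p.1 ≤ k + 1}

/-- The start time `t`. -/
def TrajIndex.start {k : ℕ} (p : TrajIndex k) : ℕ := p.1.1

/-- The length `ν`. -/
def TrajIndex.len {k : ℕ} (p : TrajIndex k) : ℕ := p.1.2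

/-- The single-trajectory space up to time step `k`: the disjoint union over `(t, ν)` of
`{t} × 𝒳 ^ ν`. -/
abbrev Traj (k : ℕ) (𝒳 : Type*) : Type _ := Σ p : TrajIndex k, (Fin p.len → 𝒳)

/-- The last state `x ^ ν` of a trajectory. -/
def Traj.last {k : ℕ} {𝒳 : Type*} (X : Traj k 𝒳) : 𝒳 :=
  X.2 ⟨X.1.len - 1, Nat.sub_lt X.1.2.2.1 Nat.one_pos⟩

/-- The trajectory is alive at time step `k`, i.e. `t + ν - 1 = k`. -/
def Traj.Alive {k : ℕ} {𝒳 : Type*} (X : Traj k 𝒳) : Prop := X.1.start + X.1.len = k + 1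

/-- The reference measure on trajectories:
`∫ π(X) dX = ∑ over (t, ν) of ∫ π(t, x¹, …, x^ν) dx¹ ⋯ dx^ν`, where `μ` is the reference measure
`dx` of the single-object space. -/
def trajMeasure (k : ℕ) {𝒳 : Type*} [MeasurableSpace 𝒳] (μ : Measure 𝒳) :
    Measure (Traj k 𝒳) :=
  Measure.sum fun p : TrajIndex k => (Measure.pi fun _ : Fin p.len => μ).map (Sigma.mk p)

/-! ### Finite sets and the set integral -/

/-- The space `ℱ(α)` of finite subsets of `α`. It is a copy of `Finset α` which carries the
σ-algebra below, because the instance on `Finset α` does not see the σ-algebra of `α`. -/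
def FinSet (α : Type*) : Type _ := Finset α

open scoped Classical in
/-- The finite set `{x₁, …, x_N}` of the entries of a vector. -/
def toSet {α : Type*} {N : ℕ} (x : Fin N → α) : FinSet α := Finset.univ.image x

/-- A set of finite sets is measurable if, for every `N`, the set of vectors `(x₁, …, x_N)` with
`{x₁, …, x_N}` in it is measurable. -/
instance finSetMeasurableSpace {α : Type*} [MeasurableSpace α] : MeasurableSpace (FinSet α) :=
  ⨅ N : ℕ, MeasurableSpace.map (fun x : Fin N → α => toSet x) inferInstance

theorem measurable_toSet {α : Type*} [MeasurableSpace α] (N : ℕ) :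
    Measurable fun x : Fin N → α => toSet x :=
  measurable_iff_le_map.mpr (iInf_le _ N)

/-- The reference measure on finite sets whose integral is the set integral
`∫ f(𝐗) δ𝐗 = ∑_N 1/N! ∫ f({x₁, …, x_N}) dν(x₁) ⋯ dν(x_N)`. -/
def setMeasure {α : Type*} [MeasurableSpace α] (ν : Measure α) : Measure (FinSet α) :=
  Measure.sum fun N : ℕ =>
    ((N ! : ℝ≥0∞))⁻¹ • (Measure.pi fun _ : Fin N => ν).map (fun x => toSet x)

/-- The reference measure on pairs `(u, X)` of an auxiliary variable `u ∈ {0, …, c}` and a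
trajectory `X`: counting measure times the reference measure on trajectories. -/
def augMeasure (c k : ℕ) {𝒳 : Type*} [MeasurableSpace 𝒳] (μ : Measure 𝒳) :
    Measure (Fin (c + 1) × Traj k 𝒳) :=
  Measure.count.prod (trajMeasure k μ)

/-- The density of a Poisson point process with intensity `lam` at a finite set `S`:
`exp (-⟨lam, 1⟩) * ∏_{x ∈ S} lam x`. -/
def pppDensity {α : Type*} [MeasurableSpace α] (ν : Measure α) (lam : α → ℝ) (S : Finset α) : ℝ :=
  Real.exp (-∫ x, lam x ∂ν) * ∏ x ∈ S, lam x

/-- The set function which is `e` at the empty set, `g x` at a singleton `{x}`, and `0` at all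
sets with more than one element. -/
def bernoulliLike {α : Type*} (e : ℝ) (g : α → ℝ) (S : Finset α) : ℝ :=
  if S.card = 0 then e else if S.card = 1 then ∏ x ∈ S, g x else 0

/-- The elements of a set of augmented trajectories whose auxiliary variable is `u`. -/
def component {c k : ℕ} {𝒳 : Type*} (S : Finset (Fin (c + 1) × Traj k 𝒳)) (u : Fin (c + 1)) :
    Finset (Fin (c + 1) × Traj k 𝒳) :=
  S.filter fun x => x.1 = u

/-! ### The predicted density and the measurement model -/

/-- Parameters of a predicted trajectory Poisson multi-Bernoulli density with `n` Bernoulli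
components: the intensity of undetected trajectories and, for each Bernoulli component, its
probability of existence and its single-trajectory density. -/
structure PMB (n k : ℕ) {𝒳 : Type*} [MeasurableSpace 𝒳] (μ : Measure 𝒳) where
  /-- the Poisson intensity `λ_{k|k-1}` -/
  lam : Traj k 𝒳 → ℝ
  lam_nonneg : ∀ X, 0 ≤ lam X
  lam_measurable : Measurable lam
  lam_integrable : Integrable lam (trajMeasure k μ)
  /-- the probabilities of existence `r^i_{k|k-1}` -/
  r : Fin n → ℝ
  r_nonneg : ∀ i, 0 ≤ r i
  r_le_one : ∀ i, r i ≤ 1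
  /-- the single-trajectory densities `f^i_{k|k-1}` -/
  f : Fin n → Traj k 𝒳 → ℝ
  f_nonneg : ∀ i X, 0 ≤ f i X
  f_measurable : ∀ i, Measurable (f i)
  f_density : ∀ i, ∫⁻ X, ENNReal.ofReal (f i X) ∂(trajMeasure k μ) = 1

/-- The Poisson spatial measurement model in `ℝ ^ d` with Poisson clutter. -/
structure MeasModel (d : ℕ) (𝒳 : Type*) [MeasurableSpace 𝒳] where
  /-- the Poisson rate `γ_k(x)` of the number of measurements of an object with state `x` -/
  rate : 𝒳 → ℝ
  rate_nonneg : ∀ x, 0 ≤ rate x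
  rate_measurable : Measurable rate
  /-- the spatial density `ℓ_k(z | x)` of a measurement `z` of an object with state `x` -/
  spatial : EuclideanSpace ℝ (Fin d) → 𝒳 → ℝ
  spatial_nonneg : ∀ z x, 0 ≤ spatial z x
  spatial_measurable : Measurable fun p : EuclideanSpace ℝ (Fin d) × 𝒳 => spatial p.1 p.2
  spatial_density : ∀ x, ∫⁻ z, ENNReal.ofReal (spatial z x) = 1
  /-- the clutter rate `γ^C_k` -/
  clutterRate : ℝ
  clutterRate_nonneg : 0 ≤ clutterRate
  /-- the clutter spatial density `μ^C_k` -/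
  clutterSpatial : EuclideanSpace ℝ (Fin d) → ℝ
  clutterSpatial_nonneg : ∀ z, 0 ≤ clutterSpatial z
  clutterSpatial_measurable : Measurable clutterSpatial
  clutterSpatial_density : ∫⁻ z, ENNReal.ofReal (clutterSpatial z) = 1

namespace MeasModel

variable {d k : ℕ} {𝒳 : Type*} [MeasurableSpace 𝒳] (M : MeasModel d 𝒳)

/-- The clutter intensity `λ^C_k(z) = γ^C_k μ^C_k(z)`. -/
def clutter (z : EuclideanSpace ℝ (Fin d)) : ℝ := M.clutterRate * M.clutterSpatial z

open scoped Classical in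
/-- The measurement rate of a trajectory: `γ_k(t, x^{1:ν}) = γ_k(x^ν) δ_k[t + ν - 1]`. -/
def trajRate (X : Traj k 𝒳) : ℝ := if X.Alive then M.rate X.last else 0

open scoped Classical in
/-- The spatial density of a trajectory: `ℓ_k(z | t, x^{1:ν}) = ℓ_k(z | x^ν) δ_k[t + ν - 1]`. -/
def trajSpatial (z : EuclideanSpace ℝ (Fin d)) (X : Traj k 𝒳) : ℝ :=
  if X.Alive then M.spatial z X.last else 0

/-- The Poisson set likelihood `ℓ_k(𝐰 | X) = exp (-γ_k(X)) ∏_{z ∈ 𝐰} γ_k(X) ℓ_k(z | X)`. -/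
def setLik (w : Finset (EuclideanSpace ℝ (Fin d))) (X : Traj k 𝒳) : ℝ :=
  Real.exp (-M.trajRate X) * ∏ z ∈ w, M.trajRate X * M.trajSpatial z X

end MeasModel

/-- The intensity on the augmented space: `δ_0[u] lam(X)`. -/
def augIntensity {c k : ℕ} {𝒳 : Type*} (lam : Traj k 𝒳 → ℝ) (x : Fin (c + 1) × Traj k 𝒳) : ℝ :=
  if x.1 = 0 then lam x.2 else 0

/-- The predicted PMB density on finite subsets of `{0, …, n} × T_(k)`: the Poisson density of the
elements with auxiliary variable `0` times, for `i = 1, …, n`, the Bernoulli density of the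
elements with auxiliary variable `i` (the Bernoulli component `i` has the index `i - 1` in
`Fin n`). -/
def PMB.density {n k : ℕ} {𝒳 : Type*} [MeasurableSpace 𝒳] {μ : Measure 𝒳} (P : PMB n k μ)
    (S : Finset (Fin (n + 1) × Traj k 𝒳)) : ℝ :=
  pppDensity (augMeasure n k μ) (augIntensity P.lam) (component S 0) *
    ∏ i : Fin n, bernoulliLike (1 - P.r i)
      (fun x => if x.1 = i.succ then P.r i * P.f i x.2 else 0) (component S i.succ)

/-! ### The joint posterior -/

/-- The label `i + 1` of the existing Bernoulli component with index `i : Fin n`. -/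
def exLabel {n : ℕ} (m : ℕ) (i : Fin n) : Fin (n + m + 1) :=
  ⟨i.1 + 1, by omega⟩

/-- The label `n + j + 1` of the new Bernoulli component created by the measurement with index
`j : Fin m`. -/
def newLabel (n : ℕ) {m : ℕ} (j : Fin m) : Fin (n + m + 1) :=
  ⟨n + j.1 + 1, by omega⟩

/-- The possible values of the measurement-oriented association vector: with measurements counted
from `1`, `β ^ j ∈ {0, 1, …, n, n + j, …, n + m}`. -/
def Admissible {n m : ℕ} (β : Fin m → Fin (n + m + 1)) : Prop :=
  ∀ j : Fin m, (β j).1 ≤ n ∨ n + j.1 + 1 ≤ (β j).1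

/-- The indices of the measurements whose origin under `θ` is `o`. The origin of a measurement is
an element `some i` of the vector of trajectories, or clutter (`none`). -/
def cell {m N : ℕ} (θ : Fin m → Option (Fin N)) (o : Option (Fin N)) : Finset (Fin m) :=
  Finset.univ.filter fun j => θ j = o

open scoped Classical in
/-- The measurements whose origin under `θ` is `o`. -/
def cellMeas {d m N : ℕ} (z : Fin m → EuclideanSpace ℝ (Fin d)) (θ : Fin m → Option (Fin N))
    (o : Option (Fin N)) : Finset (EuclideanSpace ℝ (Fin d)) :=
  (cell θ o).image z

/-- The updated auxiliary variable of a trajectory with predicted auxiliary variable `u` which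
generates the measurements with indices in `s`. It is unchanged for a trajectory of one of the `n`
existing Bernoulli components. A trajectory of the Poisson part keeps the label `0` if it stays
undetected; if it is detected, it belongs to the new Bernoulli component created by the last of
its measurements. -/
def updatedLabel {n m : ℕ} (u : Fin (n + 1)) (s : Finset (Fin m)) : Fin (n + m + 1) :=
  if u = 0 then (if h : s.Nonempty then newLabel n (s.max' h) else 0)
  else ⟨u.1, by omega⟩

/-- The updated augmented trajectories. -/
def updatedVec {n m k N : ℕ} {𝒳 : Type*} (x : Fin N → Fin (n + 1) × Traj k 𝒳)
    (θ : Fin m → Option (Fin N)) (i : Fin N) : Fin (n + m + 1) × Traj k 𝒳 :=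
  (updatedLabel (x i).1 (cell θ (some i)), (x i).2)

/-- The measurement-oriented association vector: `β ^ j` is `0` if the measurement `j` is clutter,
and otherwise the updated label of the trajectory that generated it. -/
def assocVec {n m k N : ℕ} {𝒳 : Type*} (x : Fin N → Fin (n + 1) × Traj k 𝒳)
    (θ : Fin m → Option (Fin N)) (j : Fin m) : Fin (n + m + 1) :=
  match θ j with
  | none => 0
  | some i => (updatedVec x θ i).1

theorem measurable_update (n m k N : ℕ) {𝒳 : Type*} [MeasurableSpace 𝒳]
    (θ : Fin m → Option (Fin N)) :
    Measurable fun x : Fin N → Fin (n + 1) × Traj k 𝒳 =>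
      ((toSet (updatedVec (m := m) x θ), assocVec x θ) :
        FinSet (Fin (n + m + 1) × Traj k 𝒳) × (Fin m → Fin (n + m + 1))) := by
  have h1 : ∀ i : Fin N, Measurable fun x : Fin N → Fin (n + 1) × Traj k 𝒳 =>
      (updatedLabel (x i).1 (cell θ (some i)) : Fin (n + m + 1)) := fun i =>
    (measurable_of_finite fun u : Fin (n + 1) =>
      (updatedLabel u (cell θ (some i)) : Fin (n + m + 1))).comp
        (measurable_fst.comp (measurable_pi_apply i))
  refine Measurable.prodMk ((measurable_toSet N).comp ?_) ?_
  · refine measurable_pi_lambda _ fun i => ?_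
    exact (h1 i).prodMk (measurable_snd.comp (measurable_pi_apply i))
  · refine measurable_pi_lambda _ fun j => ?_
    unfold assocVec
    cases h : θ j with
    | none => exact measurable_const
    | some i => exact h1 i

/-- The joint density of the measurements and their origins `θ`, given the trajectories `x`:
the clutter is a Poisson point process, and the trajectories generate their sets of measurements
independently of each other and of the clutter. -/
def assocLik {d n m k N : ℕ} {𝒳 : Type*} [MeasurableSpace 𝒳] (M : MeasModel d 𝒳)
    (z : Fin m → EuclideanSpace ℝ (Fin d)) (x : Fin N → Fin (n + 1) × Traj k 𝒳)
    (θ : Fin m → Option (Fin N)) : ℝ :=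
  pppDensity volume M.clutter (cellMeas z θ none) *
    ∏ i : Fin N, M.setLik (cellMeas z θ (some i)) (x i).2

/-- The unnormalized joint law of the set of (updated) augmented trajectories and of the
association vector, for the observed measurements `z`: prior density times joint density of the
measurements and their origins, summed over all origins and integrated with the set integral. Its
total mass is the evidence `∫ f(𝐗) p(𝐳 | 𝐗) δ𝐗`, where `p(𝐳 | 𝐗)`, the sum of `assocLik` over all
origins, is the multi-object likelihood. -/
def jointMeasure {d n m k : ℕ} {𝒳 : Type*} [MeasurableSpace 𝒳] {μ : Measure 𝒳} (P : PMB n k μ)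
    (M : MeasModel d 𝒳) (z : Fin m → EuclideanSpace ℝ (Fin d)) :
    Measure (FinSet (Fin (n + m + 1) × Traj k 𝒳) × (Fin m → Fin (n + m + 1))) :=
  Measure.sum fun N : ℕ => ((N ! : ℝ≥0∞))⁻¹ •
    ∑ θ : Fin m → Option (Fin N),
      ((Measure.pi fun _ : Fin N => augMeasure n k μ).withDensity fun x =>
          ENNReal.ofReal (P.density (toSet x) * assocLik M z x θ)).map
        fun x => (toSet (updatedVec x θ), assocVec x θ)

/-- The joint posterior law of the set of augmented trajectories and of the measurement-oriented
association vector, by Bayes' rule. -/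
def jointPosterior {d n m k : ℕ} {𝒳 : Type*} [MeasurableSpace 𝒳] {μ : Measure 𝒳} (P : PMB n k μ)
    (M : MeasModel d 𝒳) (z : Fin m → EuclideanSpace ℝ (Fin d)) :
    Measure (FinSet (Fin (n + m + 1) × Traj k 𝒳) × (Fin m → Fin (n + m + 1))) :=
  (jointMeasure P M z Set.univ)⁻¹ • jointMeasure P M z

/-- The reference measure for joint densities: the set integral over finite subsets of
`{0, …, n + m} × T_(k)` and the sum over the admissible association vectors. -/
def jointReference (n m k : ℕ) {𝒳 : Type*} [MeasurableSpace 𝒳] (μ : Measure 𝒳) :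
    Measure (FinSet (Fin (n + m + 1) × Traj k 𝒳) × (Fin m → Fin (n + m + 1))) :=
  (setMeasure (augMeasure (n + m) k μ)).prod (Measure.count.restrict {β | Admissible β})

/-! ### The factors -/

section Factors

variable {d n k c : ℕ} {𝒳 : Type*} [MeasurableSpace 𝒳] {μ : Measure 𝒳}

/-- The density of the Poisson point process of undetected trajectories, with intensity
`λ_{k|k}(X) = ℓ_k(∅ | X) λ_{k|k-1}(X)`. -/
def undetectedFactor (P : PMB n k μ) (M : MeasModel d 𝒳)
    (S : Finset (Fin (c + 1) × Traj k 𝒳)) : ℝ :=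
  pppDensity (augMeasure c k μ) (augIntensity fun X => M.setLik ∅ X * P.lam X) S

/-- The prior factor of the existing Bernoulli component `i`, which has the label `l`. -/
def existingPrior (P : PMB n k μ) (M : MeasModel d 𝒳) (i : Fin n) (l : Fin (c + 1))
    (S : Finset (Fin (c + 1) × Traj k 𝒳)) : ℝ :=
  bernoulliLike (1 - P.r i)
    (fun x => if x.1 = l then P.r i * P.f i x.2 * Real.exp (-M.trajRate x.2) else 0) S

/-- The prior factor of the new Bernoulli component with label `l`. -/
def newPrior (P : PMB n k μ) (M : MeasModel d 𝒳) (l : Fin (c + 1))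
    (S : Finset (Fin (c + 1) × Traj k 𝒳)) : ℝ :=
  bernoulliLike 1 (fun x => if x.1 = l then P.lam x.2 * Real.exp (-M.trajRate x.2) else 0) S

/-- `ℓ_k(z | X) γ_k(X) δ_l[u] / λ^C_k(z)` if the set is a singleton `{(u, X)}`, otherwise `0`. -/
def likRatio (M : MeasModel d 𝒳) (l : Fin (c + 1)) (S : Finset (Fin (c + 1) × Traj k 𝒳))
    (z : EuclideanSpace ℝ (Fin d)) : ℝ :=
  bernoulliLike 0
    (fun x => if x.1 = l then M.trajSpatial z x.2 * M.trajRate x.2 / M.clutter z else 0) S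

/-- The pairwise factor `s̲_k` of the component with label `l`: the likelihood ratio at a singleton
if `b = l`, the value `1` if `b ≠ l`, and `0` otherwise. -/
def sUnder (M : MeasModel d 𝒳) (l : Fin (c + 1)) (S : Finset (Fin (c + 1) × Traj k 𝒳))
    (b : Fin (c + 1)) (z : EuclideanSpace ℝ (Fin d)) : ℝ :=
  if b = l then likRatio M l S z else 1

/-- The pairwise factor `s̅_k` of the component with label `l`: the likelihood ratio at a singleton
if `b = l`, the value `1` at the empty set if `b ≠ l`, and `0` otherwise. -/
def sOver (M : MeasModel d 𝒳) (l : Fin (c + 1)) (S : Finset (Fin (c + 1) × Traj k 𝒳))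
    (b : Fin (c + 1)) (z : EuclideanSpace ℝ (Fin d)) : ℝ :=
  if b = l then likRatio M l S z else if S.card = 0 then 1 else 0

end Factors

end TrajectoryPMB

end

/-!
Conditionally on the number `N` of trajectories and on the trajectories `X₁, …, X_N` themselves, which
are almost surely distinct because the reference measure has no atoms, the prior and the measurement
model are a finite sum over the predicted labels `u` and the origins `θ` of the measurements, and the
joint law to be computed is its image under `(u, θ) ↦ (v, β)`, the updated labels and the association
vector.

This map is injective on the label vectors `u` which use each Bernoulli label at most once
(`origin_eq_of_update_eq`), and the other ones have prior density zero. Indeed `u` can be read off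
from `v`, and no two trajectories share a nonzero updated label, so that `β ^ j` determines the origin
of the measurement `j` (`origin_eq_some_iff`). Conversely, an admissible pair `(v, β)` at which the
product of the factors does not vanish is in the image
(`exists_origin_of_posteriorFactor_ne_zero`): the Bernoulli factors forbid repeated labels, the
factors of the pairs forbid associations with absent components, and the factor `s̅` forces the last
measurement of a new component to be the one that created it.

At corresponding points the two densities are proportional (`density_mul_assocLik`): dividing by the
clutter intensity of all measurements leaves the weight `exp (-γ(X)) ∏ ℓ(z | X) γ(X) / λ^C(z)` for each
trajectory (`assocLik_eq`), and sorting these weights by updated label gives exactly the factors of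
the components (`existing_factor`, `new_factor`). Summation over `(u, θ)` thus becomes summation over
`(v, β)` (`sum_origins_eq`), and integration over the trajectories identifies the measures
(`jointMeasure_eq`). The remaining constant is the normalization by the evidence.
-/

noncomputable section

namespace TrajectoryPMB

/-! ### Measurability on disjoint unions and on spaces of finite sets -/

theorem measurableSet_sigma_iff {ι : Type*} {β : ι → Type*} [∀ a, MeasurableSpace (β a)]
    {s : Set (Σ a, β a)} : MeasurableSet s ↔ ∀ a, MeasurableSet (Sigma.mk a ⁻¹' s) :=
  MeasurableSpace.measurableSet_iInf

theorem measurableEmbedding_sigmaMk {ι : Type*} {β : ι → Type*} [∀ a, MeasurableSpace (β a)]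
    (a : ι) : MeasurableEmbedding (Sigma.mk a : β a → Σ a, β a) where
  injective := sigma_mk_injective
  measurable := fun _ hs => measurableSet_sigma_iff.mp hs a
  measurableSet_image' := by
    intro s hs
    refine measurableSet_sigma_iff.mpr fun b => ?_
    rcases eq_or_ne b a with rfl | hb
    · rwa [Set.preimage_image_eq _ sigma_mk_injective]
    · rw [Set.preimage_image_sigmaMk_of_ne hb]
      exact MeasurableSet.empty

instance measurableEq_sigma {ι : Type*} {β : ι → Type*} [Countable ι]
    [∀ a, MeasurableSpace (β a)] [∀ a, MeasurableEq (β a)] : MeasurableEq (Σ a, β a) where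
  measurableSet_diagonal := by
    have : Set.diagonal (Σ a, β a) =
        ⋃ a, Prod.map (Sigma.mk a) (Sigma.mk a) '' Set.diagonal (β a) := by
      ext ⟨⟨a, x⟩, ⟨b, y⟩⟩
      simp only [Set.mem_diagonal_iff, Set.mem_iUnion, Set.mem_image, Prod.exists, Prod.map_apply,
        Prod.mk.injEq]
      constructor
      · intro h
        exact ⟨a, x, x, rfl, rfl, h⟩
      · rintro ⟨c, p, q, hpq, h1, h2⟩
        rw [← h1, ← h2, hpq]
    rw [this]
    exact MeasurableSet.iUnion fun a =>
      ((measurableEmbedding_sigmaMk a).prodMap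
        (measurableEmbedding_sigmaMk a)).measurableSet_image' measurableSet_diagonal

instance measurableEq_prod {α β : Type*} [MeasurableSpace α] [MeasurableSpace β] [MeasurableEq α]
    [MeasurableEq β] : MeasurableEq (α × β) where
  measurableSet_diagonal := by
    have : Set.diagonal (α × β) = {p | p.1.1 = p.2.1} ∩ {p | p.1.2 = p.2.2} := by
      ext p
      simp [Prod.ext_iff]
    rw [this]
    exact (measurableSet_eq_fun (by fun_prop) (by fun_prop)).inter
      (measurableSet_eq_fun (by fun_prop) (by fun_prop))

theorem measurable_finSet {α β : Type*} [MeasurableSpace α] [MeasurableSpace β]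
    {g : FinSet α → β} (h : ∀ N : ℕ, Measurable fun x : Fin N → α => g (toSet x)) :
    Measurable g := by
  intro s hs
  refine MeasurableSpace.measurableSet_iInf.mpr fun N => ?_
  exact h N hs

open scoped Classical in
/-- A product over the set of entries of a vector runs over the first occurrences of the entries. -/
@[to_additive /-- A sum over the set of entries of a vector runs over the first occurrences of the
entries. -/]
theorem prod_toSet_eq {α R : Type*} [CommMonoid R] {N : ℕ} (x : Fin N → α) (g : α → R) :
    ∏ y ∈ (toSet x : Finset α), g y = ∏ i, if ∀ j < i, x j ≠ x i then g (x i) else 1 := by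
  rw [← Finset.prod_filter]
  have himg : (toSet x : Finset α) =
      (Finset.univ.filter fun i => ∀ j < i, x j ≠ x i).image x := by
    refine Finset.ext fun y => ?_
    simp only [toSet, Finset.mem_image, Finset.mem_univ, true_and, Finset.mem_filter]
    constructor
    · rintro ⟨i, rfl⟩
      have hne : (Finset.univ.filter fun j => x j = x i).Nonempty := ⟨i, by simp⟩
      have hmem := Finset.min'_mem _ hne
      simp only [Finset.mem_filter, Finset.mem_univ, true_and] at hmem
      refine ⟨_, fun j hj hx => ?_, hmem⟩
      exact absurd (Finset.min'_le _ j (by simp [hx, hmem])) (not_le.mpr hj)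
    · rintro ⟨i, -, rfl⟩
      exact ⟨i, rfl⟩
  rw [himg, Finset.prod_image]
  intro i hi j hj hij
  simp only [Finset.coe_filter, Finset.mem_univ, true_and, Set.mem_ofPred_eq] at hi hj
  rcases lt_trichotomy i j with h | h | h
  · exact absurd hij (hj i h)
  · exact h
  · exact absurd hij.symm (hi j h)

@[to_additive]
theorem measurable_prod_finSet {α R : Type*} [MeasurableSpace α] [MeasurableEq α] [CommMonoid R]
    [MeasurableSpace R] [MeasurableMul₂ R] {g : α → R} (hg : Measurable g) :
    Measurable fun S : FinSet α => ∏ y ∈ (S : Finset α), g y := by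
  classical
  refine measurable_finSet fun N => ?_
  simp_rw [prod_toSet_eq]
  refine Finset.measurable_prod _ fun i _ => Measurable.ite ?_ (by fun_prop) measurable_const
  have : {x : Fin N → α | ∀ j < i, x j ≠ x i} = ⋂ j, ⋂ (_ : j < i), {x | x j = x i}ᶜ := by
    ext x
    simp
  rw [this]
  exact MeasurableSet.iInter fun j => MeasurableSet.iInter fun _ =>
    (measurableSet_eq_fun (by fun_prop) (by fun_prop)).compl

section Component

variable {c k : ℕ} {𝒳 : Type*} [MeasurableSpace 𝒳] [MeasurableEq (Traj k 𝒳)]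

@[to_additive]
theorem measurable_prod_component {R : Type*} [CommMonoid R] [MeasurableSpace R]
    [MeasurableMul₂ R] (l : Fin (c + 1)) {g : Fin (c + 1) × Traj k 𝒳 → R} (hg : Measurable g) :
    Measurable fun S : FinSet (Fin (c + 1) × Traj k 𝒳) => ∏ y ∈ component S l, g y := by
  have h : (fun S : FinSet (Fin (c + 1) × Traj k 𝒳) => ∏ y ∈ component S l, g y) =
      fun S : FinSet (Fin (c + 1) × Traj k 𝒳) =>
        ∏ y ∈ (S : Finset (Fin (c + 1) × Traj k 𝒳)), if y.1 = l then g y else 1 :=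
    funext fun S => Finset.prod_filter _ _
  rw [h]
  exact measurable_prod_finSet
    (Measurable.ite (measurable_fst (measurableSet_singleton l)) hg measurable_const)

theorem measurable_card_component (l : Fin (c + 1)) :
    Measurable fun S : FinSet (Fin (c + 1) × Traj k 𝒳) => (component S l).card := by
  simp only [Finset.card_eq_sum_ones]
  exact measurable_sum_component l measurable_const

theorem measurable_bernoulliLike_component (l : Fin (c + 1)) (e : ℝ)
    {g : Fin (c + 1) × Traj k 𝒳 → ℝ} (hg : Measurable g) :
    Measurable fun S : FinSet (Fin (c + 1) × Traj k 𝒳) => bernoulliLike e g (component S l) := by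
  refine Measurable.ite (measurable_card_component l (measurableSet_singleton 0))
    measurable_const (Measurable.ite (measurable_card_component l (measurableSet_singleton 1))
      (measurable_prod_component l hg) measurable_const)

end Component

/-! ### The reference measures -/

instance finite_trajIndex (k : ℕ) : Finite (TrajIndex k) := by
  refine Finite.of_injective
    (fun p : TrajIndex k => ((⟨p.1.1, by have := p.2; omega⟩, ⟨p.1.2, by have := p.2; omega⟩) :
      Fin (k + 2) × Fin (k + 2))) fun p q h => ?_
  simp only [Prod.mk.injEq, Fin.mk.injEq] at h
  exact Subtype.ext (Prod.ext h.1 h.2)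

theorem measurableEq_traj (k : ℕ) {𝒳 : Type*} [TopologicalSpace 𝒳] [T2Space 𝒳]
    [SecondCountableTopology 𝒳] [MeasurableSpace 𝒳] [BorelSpace 𝒳] :
    MeasurableEq (Traj k 𝒳) := inferInstance

section Reference

variable {k : ℕ} {𝒳 : Type*} [MeasurableSpace 𝒳] (μ : Measure 𝒳) [SigmaFinite μ]

instance sigmaFinite_trajMeasure : SigmaFinite (trajMeasure k μ) := by
  have (p : TrajIndex k) :
      SigmaFinite ((Measure.pi fun _ : Fin p.len => μ).map (Sigma.mk p : _ → Traj k 𝒳)) :=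
    (measurableEmbedding_sigmaMk p).sigmaFinite_map
  exact sum.sigmaFinite _

instance nullSingletonClass_trajMeasure [NullSingletonClass μ] :
    NullSingletonClass (trajMeasure k μ) where
  measure_singleton X := by
    refine Measure.sum_apply_eq_zero.mpr fun p => ?_
    have hp : Nonempty (Fin p.len) := ⟨⟨0, p.2.2.1⟩⟩
    rw [(measurableEmbedding_sigmaMk p).map_apply]
    exact ((Set.subsingleton_singleton (a := X)).preimage sigma_mk_injective).measure_zero _

instance sigmaFinite_augMeasure (c : ℕ) : SigmaFinite (augMeasure c k μ) := by
  unfold augMeasure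
  infer_instance

instance sFinite_setMeasure {α : Type*} [MeasurableSpace α] (ν : Measure α) [SigmaFinite ν] :
    SFinite (setMeasure ν) := by
  unfold setMeasure
  infer_instance

end Reference

/-- The entries of a vector are almost everywhere distinct if the measure has no atoms. -/
theorem ae_injective_pi {α : Type*} [MeasurableSpace α] [MeasurableEq α] (τ : Measure α)
    [SigmaFinite τ] [NullSingletonClass τ] (N : ℕ) :
    ∀ᵐ x ∂(Measure.pi fun _ : Fin N => τ), Function.Injective x := by
  have key : ∀ i j : Fin N, i ≠ j → ∀ᵐ x ∂(Measure.pi fun _ : Fin N => τ), x i ≠ x j := by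
    intro i j hij
    cases N with
    | zero => exact i.elim0
    | succ n =>
      obtain ⟨j, rfl⟩ := Fin.exists_succAbove_eq hij.symm
      have hs : MeasurableSet {p : α × (Fin n → α) | p.1 = p.2 j} :=
        measurableSet_eq_fun (by fun_prop) (by fun_prop)
      have h0 : (τ.prod (Measure.pi fun _ : Fin n => τ)) {p | p.1 = p.2 j} = 0 := by
        rw [Measure.prod_apply_symm hs]
        refine (lintegral_congr fun y => ?_).trans lintegral_zero
        exact measure_singleton (y j)
      have hmp := measurePreserving_piFinSuccAbove (fun _ : Fin (n + 1) => τ) i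
      have := hmp.measure_preimage hs.nullMeasurableSet
      rw [h0] at this
      rw [ae_iff]
      simpa [MeasurableEquiv.piFinSuccAbove, Fin.insertNthEquiv, Fin.removeNth] using this
  have := ae_all_iff.mpr fun i => ae_all_iff.mpr fun j => ae_all_iff.mpr fun h => key i j h
  filter_upwards [this] with x hx i j hij
  by_contra hne
  exact hx i j hne hij

/-- Integration of vectors of pairs `(u, X)` is integration over the vectors of the `X` and
summation over the vectors of the `u`. -/
theorem pi_count_prod {α υ : Type*} [Fintype υ] [MeasurableSpace υ]
    [MeasurableSingletonClass υ] [MeasurableSpace α] (τ : Measure α) [SigmaFinite τ] (N : ℕ) :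
    (Measure.pi fun _ : Fin N => (Measure.count : Measure υ).prod τ) =
      ∑ u : Fin N → υ, (Measure.pi fun _ : Fin N => τ).map fun X i => (u i, X i) := by
  classical
  refine Measure.pi_eq fun s hs => ?_
  have hslice (i : Fin N) : ((Measure.count : Measure υ).prod τ) (s i) =
      ∑ u : υ, τ (Prod.mk u ⁻¹' s i) := by
    rw [Measure.prod_apply (hs i), lintegral_count, tsum_fintype]
  rw [Measure.finsetSum_apply]
  simp_rw [hslice, Finset.prod_univ_sum, Fintype.piFinset_univ]
  refine Finset.sum_congr rfl fun u _ => ?_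
  rw [Measure.map_apply (by fun_prop) (MeasurableSet.univ_pi hs), ← Measure.pi_pi]
  congr 1

theorem lintegral_pi_augMeasure {c k : ℕ} {𝒳 : Type*} [MeasurableSpace 𝒳] (μ : Measure 𝒳)
    [SigmaFinite μ] (N : ℕ) {F : (Fin N → Fin (c + 1) × Traj k 𝒳) → ℝ≥0∞} (hF : Measurable F) :
    ∫⁻ x, F x ∂(Measure.pi fun _ : Fin N => augMeasure c k μ) =
      ∑ u : Fin N → Fin (c + 1),
        ∫⁻ X, F (fun i => (u i, X i)) ∂(Measure.pi fun _ : Fin N => trajMeasure k μ) := by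
  unfold augMeasure
  rw [pi_count_prod, lintegral_finsetSum_measure]
  refine Finset.sum_congr rfl fun u _ => ?_
  rw [lintegral_map hF (by fun_prop)]

/-! ### Factors on vectors with distinct entries -/

section Bernoulli

variable {α ι : Type*}

@[simp]
theorem bernoulliLike_empty (e : ℝ) (g : α → ℝ) : bernoulliLike e g ∅ = e := by
  simp [bernoulliLike]

@[simp]
theorem bernoulliLike_singleton (e : ℝ) (g : α → ℝ) (a : α) : bernoulliLike e g {a} = g a := by
  simp [bernoulliLike]

theorem bernoulliLike_eq_zero {e : ℝ} {g : α → ℝ} {S : Finset α} (hS : 1 < S.card) :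
    bernoulliLike e g S = 0 := by
  rw [bernoulliLike, if_neg (by omega), if_neg (by omega)]

theorem bernoulliLike_map (e : ℝ) (g : α → ℝ) (f : ι ↪ α) (S : Finset ι) :
    bernoulliLike e g (S.map f) = bernoulliLike e (fun i => g (f i)) S := by
  simp only [bernoulliLike, Finset.card_map, Finset.prod_map]

theorem bernoulliLike_congr (e : ℝ) {g g' : α → ℝ} {S : Finset α} (h : ∀ x ∈ S, g x = g' x) :
    bernoulliLike e g S = bernoulliLike e g' S := by
  rw [bernoulliLike, bernoulliLike, Finset.prod_congr rfl h]

end Bernoulli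

/-- The indices of the entries with label `l` in a vector of labels. -/
def labelled {υ : Type*} [DecidableEq υ] {N : ℕ} (v : Fin N → υ) (l : υ) : Finset (Fin N) :=
  Finset.univ.filter fun a => v a = l

@[simp]
theorem mem_labelled {υ : Type*} [DecidableEq υ] {N : ℕ} {v : Fin N → υ} {l : υ} {a : Fin N} :
    a ∈ labelled v l ↔ v a = l := by
  simp [labelled]

@[simp]
theorem mem_cell {m N : ℕ} {θ : Fin m → Option (Fin N)} {o : Option (Fin N)} {j : Fin m} :
    j ∈ cell θ o ↔ θ j = o := by
  simp [cell]

section Factors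

variable {d n m k c N : ℕ} {𝒳 : Type*}

theorem component_toSet (v : Fin N → Fin (c + 1)) {X : Fin N → Traj k 𝒳}
    (hX : Function.Injective X) (l : Fin (c + 1)) :
    component (toSet fun a => (v a, X a)) l =
      (labelled v l).map ⟨fun a => (v a, X a), fun _ _ h => hX (Prod.ext_iff.mp h).2⟩ := by
  classical
  ext y
  simp only [component, toSet, Finset.mem_filter, Finset.mem_image, Finset.mem_univ, true_and,
    Finset.mem_map, mem_labelled]
  constructor
  · rintro ⟨⟨a, rfl⟩, h⟩
    exact ⟨a, h, rfl⟩
  · rintro ⟨a, h, rfl⟩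
    exact ⟨⟨a, rfl⟩, h⟩

theorem prod_component_toSet {R : Type*} [CommMonoid R] (v : Fin N → Fin (c + 1))
    {X : Fin N → Traj k 𝒳} (hX : Function.Injective X) (l : Fin (c + 1))
    (g : Fin (c + 1) × Traj k 𝒳 → R) :
    ∏ y ∈ component (toSet fun a => (v a, X a)) l, g y = ∏ a ∈ labelled v l, g (l, X a) := by
  rw [component_toSet v hX, Finset.prod_map]
  refine Finset.prod_congr rfl fun a ha => ?_
  rw [← mem_labelled.mp ha]
  rfl

theorem bernoulliLike_component_toSet (v : Fin N → Fin (c + 1)) {X : Fin N → Traj k 𝒳}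
    (hX : Function.Injective X) (l : Fin (c + 1)) (e : ℝ) (g : Fin (c + 1) × Traj k 𝒳 → ℝ) :
    bernoulliLike e g (component (toSet fun a => (v a, X a)) l) =
      bernoulliLike e (fun a => g (l, X a)) (labelled v l) := by
  rw [component_toSet v hX, bernoulliLike_map]
  refine bernoulliLike_congr e fun a ha => ?_
  rw [← mem_labelled.mp ha]
  rfl

variable [MeasurableSpace 𝒳] {μ : Measure 𝒳}

theorem density_toSet (P : PMB n k μ) (u : Fin N → Fin (n + 1)) {X : Fin N → Traj k 𝒳}
    (hX : Function.Injective X) :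
    P.density (toSet fun a => (u a, X a)) =
      Real.exp (-∫ x, augIntensity P.lam x ∂(augMeasure n k μ)) *
        (∏ a ∈ labelled u 0, P.lam (X a)) *
        ∏ i : Fin n, bernoulliLike (1 - P.r i) (fun a => P.r i * P.f i (X a))
          (labelled u i.succ) := by
  simp only [PMB.density, pppDensity, prod_component_toSet u hX,
    bernoulliLike_component_toSet u hX, augIntensity, if_true]

/-- The likelihood ratio `ℓ_k(z | X) γ_k(X) / λ^C_k(z)` between detection and clutter. -/
def ratio (M : MeasModel d 𝒳) (X : Traj k 𝒳) (z : EuclideanSpace ℝ (Fin d)) : ℝ :=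
  M.trajSpatial z X * M.trajRate X / M.clutter z

theorem likRatio_toSet (M : MeasModel d 𝒳) (v : Fin N → Fin (c + 1)) {X : Fin N → Traj k 𝒳}
    (hX : Function.Injective X) (l : Fin (c + 1)) (z : EuclideanSpace ℝ (Fin d)) :
    likRatio M l (component (toSet fun a => (v a, X a)) l) z =
      bernoulliLike 0 (fun a => ratio M (X a) z) (labelled v l) := by
  simp only [likRatio, bernoulliLike_component_toSet v hX, if_true, ratio]

/-- The product of all factors of the joint posterior. -/
def posteriorFactor (P : PMB n k μ) (M : MeasModel d 𝒳) (z : Fin m → EuclideanSpace ℝ (Fin d))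
    (S : FinSet (Fin (n + m + 1) × Traj k 𝒳)) (β : Fin m → Fin (n + m + 1)) : ℝ :=
  undetectedFactor P M (component S 0) *
    (∏ i : Fin n,
      (existingPrior P M i (exLabel m i) (component S (exLabel m i)) *
        ∏ j : Fin m, sUnder M (exLabel m i) (component S (exLabel m i)) (β j) (z j))) *
    ∏ i : Fin m,
      (newPrior P M (newLabel n i) (component S (newLabel n i)) *
        sOver M (newLabel n i) (component S (newLabel n i)) (β i) (z i) *
        ∏ j ∈ Finset.Iio i,
          sUnder M (newLabel n i) (component S (newLabel n i)) (β j) (z j))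

theorem posteriorFactor_toSet (P : PMB n k μ) (M : MeasModel d 𝒳)
    (z : Fin m → EuclideanSpace ℝ (Fin d)) (v : Fin N → Fin (n + m + 1)) {X : Fin N → Traj k 𝒳}
    (hX : Function.Injective X) (β : Fin m → Fin (n + m + 1)) :
    posteriorFactor P M z (toSet fun a => (v a, X a)) β =
      Real.exp (-∫ x, augIntensity (fun X => M.setLik ∅ X * P.lam X) x
          ∂(augMeasure (n + m) k μ)) *
        (∏ a ∈ labelled v 0, Real.exp (-M.trajRate (X a)) * P.lam (X a)) *
        (∏ i : Fin n,
          (bernoulliLike (1 - P.r i) (fun a => P.r i * P.f i (X a) * Real.exp (-M.trajRate (X a)))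
              (labelled v (exLabel m i)) *
            ∏ j : Fin m, if β j = exLabel m i then
              bernoulliLike 0 (fun a => ratio M (X a) (z j)) (labelled v (exLabel m i)) else 1)) *
        ∏ i : Fin m,
          (bernoulliLike 1 (fun a => P.lam (X a) * Real.exp (-M.trajRate (X a)))
              (labelled v (newLabel n i)) *
            (if β i = newLabel n i then
                bernoulliLike 0 (fun a => ratio M (X a) (z i)) (labelled v (newLabel n i))
              else if (labelled v (newLabel n i)).card = 0 then 1 else 0) *
            ∏ j ∈ Finset.Iio i, if β j = newLabel n i then
              bernoulliLike 0 (fun a => ratio M (X a) (z j)) (labelled v (newLabel n i))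
              else 1) := by
  have hcard (l : Fin (n + m + 1)) :
      (component (toSet fun a => (v a, X a)) l).card = (labelled v l).card := by
    rw [component_toSet v hX, Finset.card_map]
  simp only [posteriorFactor, undetectedFactor, pppDensity, existingPrior, newPrior, sUnder, sOver,
    prod_component_toSet v hX, bernoulliLike_component_toSet v hX, likRatio_toSet M v hX,
    hcard, augIntensity, if_true, MeasModel.setLik, Finset.prod_empty, mul_one]

end Factors

/-! ### Labels and origins -/

section Labels

variable {n m : ℕ}

theorem prod_labels {R : Type*} [CommMonoid R] (F : Fin (n + m + 1) → R) :
    ∏ l, F l = F 0 * ((∏ i : Fin n, F (exLabel m i)) * ∏ j : Fin m, F (newLabel n j)) := by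
  rw [Fin.prod_univ_succ, Fin.prod_univ_add]
  rfl

theorem label_cases (l : Fin (n + m + 1)) :
    l = 0 ∨ (∃ i : Fin n, l = exLabel m i) ∨ ∃ j : Fin m, l = newLabel n j := by
  refine Fin.cases (Or.inl rfl) (fun l => Or.inr ?_) l
  refine Fin.addCases (fun i => Or.inl ⟨i, rfl⟩) (fun j => Or.inr ⟨j, rfl⟩) l

theorem updatedLabel_of_ne_zero {u : Fin (n + 1)} (hu : u ≠ 0) (s : Finset (Fin m)) :
    (updatedLabel u s : Fin (n + m + 1)).1 = u.1 := by
  simp [updatedLabel, hu]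

@[simp]
theorem updatedLabel_zero_empty : (updatedLabel 0 (∅ : Finset (Fin m)) : Fin (n + m + 1)) = 0 := by
  simp [updatedLabel]

theorem updatedLabel_zero_of_nonempty {s : Finset (Fin m)} (hs : s.Nonempty) :
    (updatedLabel 0 s : Fin (n + m + 1)) = newLabel n (s.max' hs) := by
  simp [updatedLabel, hs]

theorem updatedLabel_eq_zero_iff {u : Fin (n + 1)} {s : Finset (Fin m)} :
    (updatedLabel u s : Fin (n + m + 1)) = 0 ↔ u = 0 ∧ s = ∅ := by
  by_cases hu : u = 0
  · subst hu
    rcases s.eq_empty_or_nonempty with rfl | hs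
    · simp
    · rw [updatedLabel_zero_of_nonempty hs]
      simp [newLabel, hs.ne_empty, Fin.ext_iff]
  · simp only [hu, false_and, iff_false]
    intro h
    have h0 := congrArg Fin.val h
    rw [updatedLabel_of_ne_zero hu] at h0
    exact hu (Fin.ext h0)

theorem updatedLabel_eq_exLabel_iff {u : Fin (n + 1)} {s : Finset (Fin m)} {i : Fin n} :
    (updatedLabel u s : Fin (n + m + 1)) = exLabel m i ↔ u = i.succ := by
  by_cases hu : u = 0
  · subst hu
    have h0 : (0 : Fin (n + 1)) ≠ i.succ := (Fin.succ_ne_zero i).symm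
    rcases s.eq_empty_or_nonempty with rfl | hs
    · simp [exLabel, Fin.ext_iff]
    · rw [updatedLabel_zero_of_nonempty hs]
      simp only [newLabel, exLabel, Fin.ext_iff, h0, iff_false]
      have := i.2
      simp
      omega
  · simp [Fin.ext_iff, updatedLabel_of_ne_zero hu, exLabel]

theorem updatedLabel_eq_newLabel_iff {u : Fin (n + 1)} {s : Finset (Fin m)} {j : Fin m} :
    (updatedLabel u s : Fin (n + m + 1)) = newLabel n j ↔
      u = 0 ∧ j ∈ s ∧ ∀ j' ∈ s, j' ≤ j := by
  by_cases hu : u = 0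
  · subst hu
    rcases s.eq_empty_or_nonempty with rfl | hs
    · simp [newLabel, Fin.ext_iff]
    · rw [updatedLabel_zero_of_nonempty hs]
      have : newLabel n (s.max' hs) = newLabel n j ↔ s.max' hs = j := by
        simp [newLabel, Fin.ext_iff]
      rw [this, Finset.max'_eq_iff]
      simp
  · have := u.2
    simp only [hu, false_and, iff_false, Fin.ext_iff, updatedLabel_of_ne_zero hu, newLabel]
    omega

/-- The predicted label can be read off from the updated label. -/
theorem val_eq_of_updatedLabel (u : Fin (n + 1)) (s : Finset (Fin m)) :
    u.1 = if (updatedLabel u s : Fin (n + m + 1)).1 ≤ n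
      then (updatedLabel u s : Fin (n + m + 1)).1 else 0 := by
  by_cases hu : u = 0
  · subst hu
    rcases s.eq_empty_or_nonempty with rfl | hs
    · simp
    · rw [updatedLabel_zero_of_nonempty hs, if_neg]
      · rfl
      · simp only [newLabel]
        omega
  · have := u.2
    rw [updatedLabel_of_ne_zero hu, if_pos (by omega)]

end Labels

section Origins

variable {n m k N : ℕ} {𝒳 : Type*}

/-- The updated labels of trajectories with predicted labels `u` and measurement origins `θ`. -/
def newLabels (u : Fin N → Fin (n + 1)) (θ : Fin m → Option (Fin N)) (a : Fin N) :
    Fin (n + m + 1) :=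
  updatedLabel (u a) (cell θ (some a))

/-- The association vector of predicted labels `u` and measurement origins `θ`. -/
def assoc (u : Fin N → Fin (n + 1)) (θ : Fin m → Option (Fin N)) (j : Fin m) :
    Fin (n + m + 1) :=
  (θ j).elim 0 (newLabels u θ)

theorem updatedVec_eq (u : Fin N → Fin (n + 1)) (X : Fin N → Traj k 𝒳)
    (θ : Fin m → Option (Fin N)) :
    updatedVec (fun a => (u a, X a)) θ = fun a => (newLabels u θ a, X a) := rfl

theorem assocVec_eq (u : Fin N → Fin (n + 1)) (X : Fin N → Traj k 𝒳)
    (θ : Fin m → Option (Fin N)) :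
    assocVec (fun a => (u a, X a)) θ = assoc u θ := by
  funext j
  unfold assocVec assoc
  cases θ j <;> rfl

theorem assoc_of_none {u : Fin N → Fin (n + 1)} {θ : Fin m → Option (Fin N)} {j : Fin m}
    (h : θ j = none) : assoc u θ j = 0 := by
  simp [assoc, h]

theorem assoc_of_some {u : Fin N → Fin (n + 1)} {θ : Fin m → Option (Fin N)} {j : Fin m}
    {a : Fin N} (h : θ j = some a) : assoc u θ j = newLabels u θ a := by
  simp [assoc, h]

theorem newLabels_ne_zero_of_some {u : Fin N → Fin (n + 1)} {θ : Fin m → Option (Fin N)}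
    {j : Fin m} {a : Fin N} (h : θ j = some a) : newLabels u θ a ≠ 0 := by
  intro h0
  have := (updatedLabel_eq_zero_iff.mp h0).2
  have hj : j ∈ cell θ (some a) := mem_cell.mpr h
  simp [this] at hj

theorem admissible_assoc (u : Fin N → Fin (n + 1)) (θ : Fin m → Option (Fin N)) :
    Admissible (assoc u θ) := by
  intro j
  cases h : θ j with
  | none =>
    left
    simp [assoc_of_none h]
  | some a =>
    rw [assoc_of_some h]
    by_cases hu : u a = 0
    · right
      have hne : (cell θ (some a)).Nonempty := ⟨j, mem_cell.mpr h⟩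
      have hle := Finset.le_max' _ j (mem_cell.mpr h)
      rw [newLabels, hu, updatedLabel_zero_of_nonempty hne]
      simp only [newLabel]
      have : j.1 ≤ _ := hle
      omega
    · left
      have := (u a).2
      rw [newLabels, updatedLabel_of_ne_zero hu]
      omega

/-- No two entries have the same nonzero label. -/
def LabelInjective {c : ℕ} (v : Fin N → Fin (c + 1)) : Prop :=
  ∀ a b, v a = v b → v a ≠ 0 → a = b

theorem LabelInjective.newLabels {u : Fin N → Fin (n + 1)} (hu : LabelInjective u)
    (θ : Fin m → Option (Fin N)) : LabelInjective (newLabels u θ) := by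
  intro a b hab ha
  rcases label_cases (TrajectoryPMB.newLabels u θ a) with h | ⟨i, h⟩ | ⟨j, h⟩
  · exact absurd h ha
  · have h1 := updatedLabel_eq_exLabel_iff.mp h
    have h2 := updatedLabel_eq_exLabel_iff.mp (hab ▸ h)
    exact hu a b (h1.trans h2.symm) (h1 ▸ Fin.succ_ne_zero i)
  · -- two trajectories with the same new label would both have generated the measurement `j`
    have h1 := mem_cell.mp (updatedLabel_eq_newLabel_iff.mp h).2.1
    have h2 := mem_cell.mp (updatedLabel_eq_newLabel_iff.mp (hab ▸ h)).2.1
    exact Option.some_injective _ (h1.symm.trans h2)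

theorem origin_eq_some_iff {u : Fin N → Fin (n + 1)} (hu : LabelInjective u)
    {θ : Fin m → Option (Fin N)} {j : Fin m} {a : Fin N} :
    θ j = some a ↔ assoc u θ j ≠ 0 ∧ newLabels u θ a = assoc u θ j := by
  constructor
  · intro h
    rw [assoc_of_some h]
    exact ⟨newLabels_ne_zero_of_some h, rfl⟩
  · rintro ⟨h0, h⟩
    cases hj : θ j with
    | none => exact absurd (assoc_of_none hj) h0
    | some b =>
      rw [assoc_of_some hj] at h h0
      rw [hu.newLabels θ a b h (h ▸ h0)]

theorem origin_eq_of_update_eq {u u' : Fin N → Fin (n + 1)} (hu : LabelInjective u)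
    (hu' : LabelInjective u') {θ θ' : Fin m → Option (Fin N)}
    (hl : newLabels u θ = newLabels u' θ') (ha : assoc u θ = assoc u' θ') :
    u = u' ∧ θ = θ' := by
  constructor
  · funext a
    have h : newLabels u θ a = newLabels u' θ' a := congrFun hl a
    rw [newLabels, newLabels] at h
    rw [Fin.ext_iff, val_eq_of_updatedLabel (u a) (cell θ (some a)), h,
      ← val_eq_of_updatedLabel]
  · funext j
    refine Option.ext fun a => ?_
    rw [origin_eq_some_iff hu, origin_eq_some_iff hu', hl, ha]

/-- A label vector and an association vector come from predicted labels and measurement origins,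
provided that the nonzero labels are used at most once, that associations refer to existing
trajectories, and that a trajectory with the `j`-th new label is associated with the
measurement `j`. -/
theorem exists_origin {v : Fin N → Fin (n + m + 1)} {β : Fin m → Fin (n + m + 1)}
    (hβ : Admissible β) (hv : LabelInjective v) (hex : ∀ j, β j ≠ 0 → ∃ a, v a = β j)
    (hnew : ∀ j a, v a = newLabel n j → β j = newLabel n j) :
    ∃ (u : Fin N → Fin (n + 1)) (θ : Fin m → Option (Fin N)),
      LabelInjective u ∧ newLabels u θ = v ∧ assoc u θ = β := by
  classical
  let u : Fin N → Fin (n + 1) := fun a =>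
    if h : (v a).1 ≤ n then ⟨(v a).1, Nat.lt_succ_of_le h⟩ else 0
  let θ : Fin m → Option (Fin N) := fun j =>
    if h : β j = 0 then none else some (hex j h).choose
  have hθn {j : Fin m} (h : β j = 0) : θ j = none := dif_pos h
  have hθs {j : Fin m} (h : β j ≠ 0) : ∃ a, θ j = some a ∧ v a = β j :=
    ⟨_, dif_neg h, (hex j h).choose_spec⟩
  have hθ {j : Fin m} {a : Fin N} : θ j = some a ↔ β j ≠ 0 ∧ v a = β j := by
    by_cases h : β j = 0
    · simp [hθn h, h]
    · obtain ⟨b, hb, hvb⟩ := hθs h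
      rw [hb]
      constructor
      · intro hab
        rw [← Option.some_injective _ hab]
        exact ⟨h, hvb⟩
      · rintro ⟨-, hva⟩
        rw [hv a b (hva.trans hvb.symm) (hva ▸ h)]
  have hlab : newLabels u θ = v := by
    funext a
    rcases label_cases (v a) with h | ⟨i, h⟩ | ⟨j, h⟩
    · rw [h]
      refine updatedLabel_eq_zero_iff.mpr ⟨by simp [u, h], ?_⟩
      refine Finset.eq_empty_of_forall_notMem fun j hj => ?_
      obtain ⟨h0, h1⟩ := hθ.mp (mem_cell.mp hj)
      exact h0 (h1.symm.trans h)
    · rw [h]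
      refine updatedLabel_eq_exLabel_iff.mpr ?_
      simp [u, h, exLabel, Fin.ext_iff]
    · rw [h]
      refine updatedLabel_eq_newLabel_iff.mpr ⟨?_, ?_, ?_⟩
      · simp only [u, h, newLabel]
        rw [dif_neg (by omega)]
      · have h1 := hnew j a h
        refine mem_cell.mpr (hθ.mpr ⟨?_, h.trans h1.symm⟩)
        rw [h1]
        simp [newLabel, Fin.ext_iff]
      · intro j' hj'
        obtain ⟨-, h1⟩ := hθ.mp (mem_cell.mp hj')
        have h2 := hβ j'
        rw [← h1, h] at h2
        simp only [newLabel] at h2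
        change j'.1 ≤ j.1
        omega
  refine ⟨u, θ, ?_, hlab, ?_⟩
  · intro a b hab ha
    have hval (a : Fin N) (ha : u a ≠ 0) : (u a).1 = (v a).1 := by
      by_cases h : (v a).1 ≤ n
      · simp [u, h]
      · exact absurd (dif_neg h) ha
    have h1 := hval a ha
    have h2 := hval b (hab ▸ ha)
    refine hv a b (Fin.ext (by rw [← h1, ← h2, hab])) fun h0 => ha (Fin.ext ?_)
    rw [h1, h0]
    rfl
  · funext j
    by_cases h : β j = 0
    · rw [assoc_of_none (hθn h), h]
    · obtain ⟨a, ha, hva⟩ := hθs h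
      rw [assoc_of_some ha, hlab, hva]

end Origins

/-! ### The factorization for fixed trajectories -/

section Factorization

variable {d n m k N : ℕ} {𝒳 : Type*} [MeasurableSpace 𝒳] {μ : Measure 𝒳}

/-- The contribution of the measurements to the weight of a trajectory: its probability of
generating nothing times the likelihood ratios of the measurements that it generates. -/
def originWeight (M : MeasModel d 𝒳) (z : Fin m → EuclideanSpace ℝ (Fin d))
    (X : Fin N → Traj k 𝒳) (θ : Fin m → Option (Fin N)) (a : Fin N) : ℝ :=
  Real.exp (-M.trajRate (X a)) * ∏ j ∈ cell θ (some a), ratio M (X a) (z j)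

/-- Factoring the clutter intensity out of all measurements turns the likelihood of the trajectories
into a product of likelihood ratios. -/
theorem assocLik_eq (M : MeasModel d 𝒳) {z : Fin m → EuclideanSpace ℝ (Fin d)}
    (hz : Function.Injective z) (hclutter : ∀ j, 0 < M.clutter (z j))
    (u : Fin N → Fin (n + 1)) (X : Fin N → Traj k 𝒳) (θ : Fin m → Option (Fin N)) :
    assocLik M z (fun a => (u a, X a)) θ =
      Real.exp (-∫ y, M.clutter y) * (∏ j, M.clutter (z j)) * ∏ a, originWeight M z X θ a := by
  have hcell (o : Option (Fin N)) (g : EuclideanSpace ℝ (Fin d) → ℝ) :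
      ∏ y ∈ cellMeas z θ o, g y = ∏ j ∈ cell θ o, g (z j) :=
    Finset.prod_image hz.injOn
  have hprod : ∏ j, M.clutter (z j) = (∏ j ∈ cell θ none, M.clutter (z j)) *
      ∏ a, ∏ j ∈ cell θ (some a), M.clutter (z j) := by
    rw [← Fintype.prod_option (fun o => ∏ j ∈ cell θ o, M.clutter (z j))]
    exact (Finset.prod_fiberwise _ θ _).symm
  have hW (a : Fin N) : M.setLik (cellMeas z θ (some a)) (X a) =
      (∏ j ∈ cell θ (some a), M.clutter (z j)) * originWeight M z X θ a := by
    rw [MeasModel.setLik, hcell, originWeight, mul_left_comm, ← Finset.prod_mul_distrib]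
    congr 1
    refine Finset.prod_congr rfl fun j _ => ?_
    rw [ratio, mul_div_cancel₀ _ (hclutter j).ne', mul_comm]
  simp only [assocLik, pppDensity, hcell, hW, hprod, Finset.prod_mul_distrib]
  ring

theorem LabelInjective.labelled_cases {c : ℕ} {v : Fin N → Fin (c + 1)} (hv : LabelInjective v)
    {l : Fin (c + 1)} (hl : l ≠ 0) : labelled v l = ∅ ∨ ∃ a, v a = l ∧ labelled v l = {a} := by
  rcases (labelled v l).eq_empty_or_nonempty with h | ⟨a, ha⟩
  · exact Or.inl h
  · have ha' := mem_labelled.mp ha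
    refine Or.inr ⟨a, ha', Finset.eq_singleton_iff_unique_mem.mpr ⟨ha, fun b hb => ?_⟩⟩
    have hb' := mem_labelled.mp hb
    exact hv b a (hb'.trans ha'.symm) (hb' ▸ hl)

theorem assoc_ne_of_labelled_eq_empty (u : Fin N → Fin (n + 1))
    (θ : Fin m → Option (Fin N)) {l : Fin (n + m + 1)} (hl : l ≠ 0)
    (h : labelled (newLabels u θ) l = ∅) (j : Fin m) : assoc u θ j ≠ l := by
  intro hj
  cases h' : θ j with
  | none => exact hl (hj ▸ assoc_of_none h')
  | some a =>
    have : a ∈ labelled (newLabels u θ) l := mem_labelled.mpr ((assoc_of_some h').symm.trans hj)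
    simp [h] at this

section Component

variable {u : Fin N → Fin (n + 1)} (hu : LabelInjective u) (θ : Fin m → Option (Fin N))
include hu

theorem assoc_eq_iff {l : Fin (n + m + 1)} (hl : l ≠ 0) {a : Fin N} (ha : newLabels u θ a = l)
    (j : Fin m) : assoc u θ j = l ↔ θ j = some a := by
  rw [origin_eq_some_iff hu, ha]
  exact ⟨fun h => ⟨h ▸ hl, h.symm⟩, fun h => h.2.symm⟩

/-- The factors of an existing Bernoulli component. -/
theorem existing_factor (i : Fin n) (q : ℝ) (ρ e : Fin N → ℝ) (L : Fin N → Fin m → ℝ) :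
    (bernoulliLike q (fun a => ρ a * e a) (labelled (newLabels u θ) (exLabel m i)) *
        ∏ j : Fin m, if assoc u θ j = exLabel m i then
          bernoulliLike 0 (fun a => L a j) (labelled (newLabels u θ) (exLabel m i)) else 1) =
      bernoulliLike q ρ (labelled u i.succ) *
        ∏ a ∈ labelled (newLabels u θ) (exLabel m i), (e a * ∏ j ∈ cell θ (some a), L a j) := by
  have hl : exLabel m i ≠ 0 := Fin.succ_ne_zero (Fin.castAdd m i)
  have hlab : labelled u i.succ = labelled (newLabels u θ) (exLabel m i) := by
    ext a
    rw [mem_labelled, mem_labelled, newLabels, updatedLabel_eq_exLabel_iff]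
  rw [hlab]
  rcases (hu.newLabels θ).labelled_cases hl with h | ⟨a, ha, h⟩
  · simp [h, assoc_ne_of_labelled_eq_empty u θ hl h]
  · simp only [h, bernoulliLike_singleton, Finset.prod_singleton, assoc_eq_iff hu θ hl ha, cell,
      Finset.prod_filter]
    ring

/-- The factors of a new Bernoulli component. -/
theorem new_factor (i : Fin m) (lam e : Fin N → ℝ) (L : Fin N → Fin m → ℝ) :
    (bernoulliLike 1 (fun a => lam a * e a) (labelled (newLabels u θ) (newLabel n i)) *
        (if assoc u θ i = newLabel n i then
            bernoulliLike 0 (fun a => L a i) (labelled (newLabels u θ) (newLabel n i))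
          else if (labelled (newLabels u θ) (newLabel n i)).card = 0 then 1 else 0) *
        ∏ j ∈ Finset.Iio i, if assoc u θ j = newLabel n i then
          bernoulliLike 0 (fun a => L a j) (labelled (newLabels u θ) (newLabel n i)) else 1) =
      ∏ a ∈ labelled (newLabels u θ) (newLabel n i),
        (lam a * (e a * ∏ j ∈ cell θ (some a), L a j)) := by
  have hl : newLabel n i ≠ 0 := Fin.succ_ne_zero (Fin.natAdd n i)
  rcases (hu.newLabels θ).labelled_cases hl with h | ⟨a, ha, h⟩
  · simp [h, assoc_ne_of_labelled_eq_empty u θ hl h]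
  · -- the measurement `i` is the last one of the measurements of the trajectory `a`
    obtain ⟨-, hi, hmax⟩ := updatedLabel_eq_newLabel_iff.mp ha
    have hcell : cell θ (some a) = insert i ((Finset.Iio i).filter fun j => θ j = some a) := by
      ext j
      simp only [mem_cell, Finset.mem_insert, Finset.mem_filter, Finset.mem_Iio]
      constructor
      · intro hj
        rcases (hmax j (mem_cell.mpr hj)).eq_or_lt with h | h
        · exact Or.inl h
        · exact Or.inr ⟨h, hj⟩
      · rintro (rfl | h)
        · exact mem_cell.mp hi
        · exact h.2
    rw [mem_cell] at hi
    simp only [h, bernoulliLike_singleton, Finset.prod_singleton, assoc_eq_iff hu θ hl ha,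
      if_pos hi]
    rw [hcell, Finset.prod_insert (by simp), Finset.prod_filter]
    ring

end Component

/-- The normalization that relates the joint density of trajectories, measurements and origins to
the product of the factors. -/
def posteriorScale (P : PMB n k μ) (M : MeasModel d 𝒳) (z : Fin m → EuclideanSpace ℝ (Fin d)) : ℝ :=
  Real.exp (-∫ x, augIntensity P.lam x ∂(augMeasure n k μ)) * Real.exp (-∫ y, M.clutter y) *
    (∏ j, M.clutter (z j)) /
    Real.exp (-∫ x, augIntensity (fun X => M.setLik ∅ X * P.lam X) x ∂(augMeasure (n + m) k μ))

theorem posteriorScale_pos (P : PMB n k μ) (M : MeasModel d 𝒳)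
    {z : Fin m → EuclideanSpace ℝ (Fin d)} (hclutter : ∀ j, 0 < M.clutter (z j)) :
    0 < posteriorScale P M z := by
  have := Finset.prod_pos fun j (_ : j ∈ Finset.univ) => hclutter j
  unfold posteriorScale
  positivity

/-- The joint density is proportional to the product of the factors, at the updated labels and the
association vector. -/
theorem density_mul_assocLik (P : PMB n k μ) (M : MeasModel d 𝒳)
    {z : Fin m → EuclideanSpace ℝ (Fin d)} (hz : Function.Injective z)
    (hclutter : ∀ j, 0 < M.clutter (z j)) {u : Fin N → Fin (n + 1)} (hu : LabelInjective u)
    {X : Fin N → Traj k 𝒳} (hX : Function.Injective X) (θ : Fin m → Option (Fin N)) :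
    P.density (toSet fun a => (u a, X a)) * assocLik M z (fun a => (u a, X a)) θ =
      posteriorScale P M z *
        posteriorFactor P M z (toSet fun a => (newLabels u θ a, X a)) (assoc u θ) := by
  rw [density_toSet P u hX, assocLik_eq M hz hclutter, posteriorFactor_toSet P M z _ hX]
  have hexist (i : Fin n) : _ = bernoulliLike (1 - P.r i) _ (labelled u i.succ) *
      ∏ a ∈ labelled (newLabels u θ) (exLabel m i), originWeight M z X θ a :=
    existing_factor hu θ i (1 - P.r i) (fun a => P.r i * P.f i (X a))
      (fun a => Real.exp (-M.trajRate (X a))) fun a j => ratio M (X a) (z j)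
  have hnew (j : Fin m) : _ = ∏ a ∈ labelled (newLabels u θ) (newLabel n j),
      P.lam (X a) * originWeight M z X θ a :=
    new_factor hu θ j (fun a => P.lam (X a)) (fun a => Real.exp (-M.trajRate (X a)))
      fun a j => ratio M (X a) (z j)
  rw [Finset.prod_congr rfl fun i _ => hexist i, Finset.prod_congr rfl fun j _ => hnew j]
  have hzero {a : Fin N} (ha : a ∈ labelled (newLabels u θ) 0) :=
    updatedLabel_eq_zero_iff.mp (show newLabels u θ a = 0 from mem_labelled.mp ha)
  have hundetected : ∏ a ∈ labelled (newLabels u θ) 0,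
      Real.exp (-M.trajRate (X a)) * P.lam (X a) =
      ∏ a ∈ labelled (newLabels u θ) 0, P.lam (X a) * originWeight M z X θ a := by
    refine Finset.prod_congr rfl fun a ha => ?_
    rw [originWeight, (hzero ha).2]
    simp [mul_comm]
  -- the Poisson part of the prior contributes the intensity of each of its trajectories
  have hweight : (∏ a ∈ labelled u 0, P.lam (X a)) * ∏ a, originWeight M z X θ a =
      (∏ a ∈ labelled (newLabels u θ) 0, P.lam (X a) * originWeight M z X θ a) *
        ((∏ i : Fin n, ∏ a ∈ labelled (newLabels u θ) (exLabel m i), originWeight M z X θ a) *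
          ∏ j : Fin m, ∏ a ∈ labelled (newLabels u θ) (newLabel n j),
            P.lam (X a) * originWeight M z X θ a) := by
    rw [labelled, Finset.prod_filter, ← Finset.prod_mul_distrib,
      ← Finset.prod_fiberwise _ (newLabels u θ), prod_labels]
    congr 1
    · refine Finset.prod_congr rfl fun a ha => ?_
      rw [if_pos (hzero ha).1]
    congr 1
    · refine Finset.prod_congr rfl fun i _ => Finset.prod_congr rfl fun a ha => ?_
      have hl : newLabels u θ a = exLabel m i := mem_labelled.mp ha
      rw [updatedLabel_eq_exLabel_iff.mp hl, if_neg (Fin.succ_ne_zero i),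
        one_mul]
    · refine Finset.prod_congr rfl fun j _ => Finset.prod_congr rfl fun a ha => ?_
      have hl : newLabels u θ a = newLabel n j := mem_labelled.mp ha
      rw [if_pos (updatedLabel_eq_newLabel_iff.mp hl).1]
  rw [hundetected]
  rw [posteriorScale]
  simp only [Finset.prod_mul_distrib] at hweight ⊢
  field_simp
  linear_combination (∏ i : Fin n, bernoulliLike (1 - P.r i) (fun a => P.r i * P.f i (X a))
    (labelled u i.succ)) * (∏ j, M.clutter (z j)) * hweight

theorem labelInjective_of_density_ne_zero (P : PMB n k μ) {u : Fin N → Fin (n + 1)}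
    {X : Fin N → Traj k 𝒳} (hX : Function.Injective X)
    (h : P.density (toSet fun a => (u a, X a)) ≠ 0) : LabelInjective u := by
  intro a b hab ha
  by_contra hne
  obtain ⟨i, hi⟩ := Fin.exists_succ_eq.mpr ha
  refine h ?_
  rw [density_toSet P u hX]
  refine mul_eq_zero_of_right _ (Finset.prod_eq_zero (Finset.mem_univ i) ?_)
  exact bernoulliLike_eq_zero (Finset.one_lt_card.mpr
    ⟨a, by simp [hi], b, by simp [hi, hab], hne⟩)

/-- The product of the factors vanishes at admissible association vectors which do not come from
measurement origins. -/
theorem exists_origin_of_posteriorFactor_ne_zero (P : PMB n k μ) (M : MeasModel d 𝒳)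
    {z : Fin m → EuclideanSpace ℝ (Fin d)} {v : Fin N → Fin (n + m + 1)}
    {X : Fin N → Traj k 𝒳} (hX : Function.Injective X) {β : Fin m → Fin (n + m + 1)}
    (hβ : Admissible β) (h : posteriorFactor P M z (toSet fun a => (v a, X a)) β ≠ 0) :
    ∃ (u : Fin N → Fin (n + 1)) (θ : Fin m → Option (Fin N)),
      LabelInjective u ∧ newLabels u θ = v ∧ assoc u θ = β := by
  rw [posteriorFactor_toSet P M z v hX] at h
  have hexist := Finset.prod_ne_zero_iff.mp (right_ne_zero_of_mul (left_ne_zero_of_mul h))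
  have hnew := Finset.prod_ne_zero_iff.mp (right_ne_zero_of_mul h)
  have hcard {e : ℝ} {g : Fin N → ℝ} {l : Fin (n + m + 1)}
      (hb : bernoulliLike e g (labelled v l) ≠ 0) {a b : Fin N} (hab : v a = v b)
      (ha : v a = l) : a = b := by
    by_contra hne
    exact hb (bernoulliLike_eq_zero (Finset.one_lt_card.mpr
      ⟨a, by simp [ha], b, by simp [← hab, ha], hne⟩))
  refine exists_origin hβ ?_ ?_ ?_
  · intro a b hab ha
    rcases label_cases (v a) with hl | ⟨i, hl⟩ | ⟨i, hl⟩
    · exact absurd hl ha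
    · exact hcard (left_ne_zero_of_mul (hexist i (Finset.mem_univ i))) hab hl
    · exact hcard (left_ne_zero_of_mul (left_ne_zero_of_mul (hnew i (Finset.mem_univ i)))) hab hl
  · intro j hj
    by_contra! hno
    have hempty : labelled v (β j) = ∅ :=
      Finset.eq_empty_of_forall_notMem fun a ha => hno a (mem_labelled.mp ha)
    rcases label_cases (β j) with hl | ⟨i, hl⟩ | ⟨i, hl⟩
    · exact hj hl
    · refine Finset.prod_ne_zero_iff.mp
        (right_ne_zero_of_mul (hexist i (Finset.mem_univ i))) j (Finset.mem_univ j) ?_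
      rw [if_pos hl, ← hl, hempty, bernoulliLike_empty]
    · -- an admissible association with the `i`-th new label has `j ≤ i`
      have hle : j ≤ i := by
        have := hβ j
        rw [hl] at this
        simp only [newLabel] at this
        change j.1 ≤ i.1
        omega
      rcases hle.eq_or_lt with rfl | hlt
      · refine right_ne_zero_of_mul (left_ne_zero_of_mul (hnew j (Finset.mem_univ j))) ?_
        rw [if_pos hl, ← hl, hempty, bernoulliLike_empty]
      · refine Finset.prod_ne_zero_iff.mp
          (right_ne_zero_of_mul (hnew i (Finset.mem_univ i))) j (Finset.mem_Iio.mpr hlt) ?_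
        rw [if_pos hl, ← hl, hempty, bernoulliLike_empty]
  · intro j a ha
    by_contra hne
    refine right_ne_zero_of_mul (left_ne_zero_of_mul (hnew j (Finset.mem_univ j))) ?_
    rw [if_neg hne, if_neg]
    exact Finset.card_ne_zero_of_mem (mem_labelled.mpr ha)

open scoped Classical in
/-- The sum over predicted labels and measurement origins, reindexed as a sum over updated labels
and admissible association vectors. -/
theorem sum_origins_eq (P : PMB n k μ) (M : MeasModel d 𝒳)
    {z : Fin m → EuclideanSpace ℝ (Fin d)} (hz : Function.Injective z)
    (hclutter : ∀ j, 0 < M.clutter (z j)) {X : Fin N → Traj k 𝒳} (hX : Function.Injective X)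
    (h : FinSet (Fin (n + m + 1) × Traj k 𝒳) × (Fin m → Fin (n + m + 1)) → ℝ≥0∞) :
    ∑ θ : Fin m → Option (Fin N), ∑ u : Fin N → Fin (n + 1),
        ENNReal.ofReal (P.density (toSet fun a => (u a, X a)) *
            assocLik M z (fun a => (u a, X a)) θ) *
          h (toSet (updatedVec (fun a => (u a, X a)) θ), assocVec (fun a => (u a, X a)) θ) =
      ∑ β ∈ Finset.univ.filter (Admissible (n := n) (m := m)), ∑ v : Fin N → Fin (n + m + 1),
        ENNReal.ofReal (posteriorScale P M z *
            posteriorFactor P M z (toSet fun a => (v a, X a)) β) *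
          h (toSet fun a => (v a, X a), β) := by
  simp only [updatedVec_eq, assocVec_eq]
  rw [← Finset.sum_product', ← Finset.sum_product']
  -- predicted label vectors which repeat a nonzero label have density zero
  rw [← Finset.sum_filter_of_ne (p := fun p : (Fin m → Option (Fin N)) × (Fin N → Fin (n + 1)) =>
    LabelInjective p.2)]
  · refine Finset.sum_of_injOn (fun p => (assoc p.2 p.1, newLabels p.2 p.1)) ?_ ?_ ?_ ?_
    · rintro ⟨θ, u⟩ hp ⟨θ', u'⟩ hp' heq
      simp only [Finset.coe_filter, Set.mem_ofPred_eq] at hp hp'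
      obtain ⟨h1, h2⟩ := Prod.ext_iff.mp heq
      obtain ⟨rfl, rfl⟩ := origin_eq_of_update_eq hp.2 hp'.2 h2 h1
      rfl
    · rintro ⟨θ, u⟩ -
      simp [admissible_assoc]
    · rintro ⟨β, v⟩ hp hnot
      have hβ : Admissible β := by simpa using hp
      have : posteriorFactor P M z (toSet fun a => (v a, X a)) β = 0 := by
        by_contra hne
        obtain ⟨u, θ, hu, rfl, rfl⟩ := exists_origin_of_posteriorFactor_ne_zero P M hX hβ hne
        exact hnot ⟨(θ, u), by simpa using hu, rfl⟩
      simp [this]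
    · rintro ⟨θ, u⟩ hp
      have hu : LabelInjective u := by simpa using hp
      simp only [density_mul_assocLik P M hz hclutter hu hX]
  · rintro ⟨θ, u⟩ - hne
    refine labelInjective_of_density_ne_zero P hX fun h0 => hne ?_
    simp [h0]

end Factorization

/-! ### Measurability of the densities -/

section Measurability

variable {d n m k N : ℕ} {𝒳 : Type*} [MeasurableSpace 𝒳] {μ : Measure 𝒳}

theorem measurable_traj {β : Type*} [MeasurableSpace β] {f : Traj k 𝒳 → β}
    (h : ∀ p : TrajIndex k, Measurable fun x : Fin p.len → 𝒳 => f ⟨p, x⟩) : Measurable f :=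
  fun _ hs => measurableSet_sigma_iff.mpr fun p => h p hs

open scoped Classical in
theorem measurable_ite_alive {g : 𝒳 → ℝ} (hg : Measurable g) :
    Measurable fun X : Traj k 𝒳 => if X.Alive then g X.last else 0 := by
  refine measurable_traj fun p => ?_
  by_cases h : p.start + p.len = k + 1
  · have hlast : Measurable fun x : Fin p.len → 𝒳 =>
        g (x ⟨p.len - 1, Nat.sub_lt p.2.2.1 Nat.one_pos⟩) := hg.comp (measurable_pi_apply _)
    simp only [Traj.Alive, h, if_true, Traj.last]
    exact hlast
  · simp only [Traj.Alive, h, if_false]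
    exact measurable_const

@[fun_prop]
theorem measurable_trajRate (M : MeasModel d 𝒳) :
    Measurable (M.trajRate : Traj k 𝒳 → ℝ) :=
  measurable_ite_alive M.rate_measurable

@[fun_prop]
theorem measurable_trajSpatial (M : MeasModel d 𝒳) (y : EuclideanSpace ℝ (Fin d)) :
    Measurable (M.trajSpatial y : Traj k 𝒳 → ℝ) :=
  measurable_ite_alive (M.spatial_measurable.comp measurable_prodMk_left)

@[fun_prop]
theorem measurable_setLik (M : MeasModel d 𝒳) (w : Finset (EuclideanSpace ℝ (Fin d))) :
    Measurable (M.setLik w : Traj k 𝒳 → ℝ) := by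
  unfold MeasModel.setLik
  fun_prop

theorem measurable_assocLik (M : MeasModel d 𝒳) (z : Fin m → EuclideanSpace ℝ (Fin d))
    (θ : Fin m → Option (Fin N)) :
    Measurable fun x : Fin N → Fin (n + 1) × Traj k 𝒳 => assocLik M z x θ := by
  unfold assocLik
  fun_prop

theorem measurable_ite_label {c : ℕ} (l : Fin (c + 1)) {g : Traj k 𝒳 → ℝ} (hg : Measurable g) :
    Measurable fun x : Fin (c + 1) × Traj k 𝒳 => if x.1 = l then g x.2 else 0 :=
  Measurable.ite (measurable_fst (measurableSet_singleton l)) (by fun_prop) measurable_const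

variable [MeasurableEq (Traj k 𝒳)]

theorem measurable_density (P : PMB n k μ) :
    Measurable fun S : FinSet (Fin (n + 1) × Traj k 𝒳) => P.density S := by
  unfold PMB.density pppDensity
  refine Measurable.mul (measurable_const.mul ?_) (Finset.measurable_prod _ fun i _ => ?_)
  · exact measurable_prod_component 0 (measurable_ite_label 0 P.lam_measurable)
  · exact measurable_bernoulliLike_component _ _
      (measurable_ite_label _ ((P.f_measurable i).const_mul _))

theorem measurable_posteriorFactor (P : PMB n k μ) (M : MeasModel d 𝒳)
    (z : Fin m → EuclideanSpace ℝ (Fin d)) (β : Fin m → Fin (n + m + 1)) :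
    Measurable fun S : FinSet (Fin (n + m + 1) × Traj k 𝒳) => posteriorFactor P M z S β := by
  have hlam := P.lam_measurable
  have hf := P.f_measurable
  have hratio (y : EuclideanSpace ℝ (Fin d)) : Measurable fun X : Traj k 𝒳 =>
      M.trajSpatial y X * M.trajRate X / M.clutter y := by fun_prop
  have hexist (i : Fin n) : Measurable fun X : Traj k 𝒳 =>
      P.r i * P.f i X * Real.exp (-M.trajRate X) := by fun_prop
  have hnew : Measurable fun X : Traj k 𝒳 => P.lam X * Real.exp (-M.trajRate X) := by fun_prop
  have hundetected : Measurable fun X : Traj k 𝒳 => M.setLik ∅ X * P.lam X := by fun_prop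
  have hunder (l b : Fin (n + m + 1)) (y : EuclideanSpace ℝ (Fin d)) :
      Measurable fun S : FinSet (Fin (n + m + 1) × Traj k 𝒳) =>
        sUnder M l (component S l) b y := by
    unfold sUnder
    split_ifs
    · exact measurable_bernoulliLike_component l 0 (measurable_ite_label l (hratio y))
    · exact measurable_const
  have hover (l b : Fin (n + m + 1)) (y : EuclideanSpace ℝ (Fin d)) :
      Measurable fun S : FinSet (Fin (n + m + 1) × Traj k 𝒳) =>
        sOver M l (component S l) b y := by
    unfold sOver
    split_ifs
    · exact measurable_bernoulliLike_component l 0 (measurable_ite_label l (hratio y))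
    · exact Measurable.ite (measurable_card_component l (measurableSet_singleton 0))
        measurable_const measurable_const
  unfold posteriorFactor
  refine Measurable.mul (Measurable.mul ?_ (Finset.measurable_prod _ fun i _ => ?_))
    (Finset.measurable_prod _ fun i _ => ?_)
  · unfold undetectedFactor pppDensity
    exact measurable_const.mul
      (measurable_prod_component 0 (measurable_ite_label 0 hundetected))
  · exact (measurable_bernoulliLike_component _ _ (measurable_ite_label _ (hexist i))).mul
      (Finset.measurable_prod _ fun j _ => hunder _ _ _)
  · exact ((measurable_bernoulliLike_component _ _ (measurable_ite_label _ hnew)).mul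
      (hover _ _ _)).mul (Finset.measurable_prod _ fun j _ => hunder _ _ _)

end Measurability

/-! ### The joint posterior -/

section Joint

variable {d n m k : ℕ} {𝒳 : Type*} [MeasurableSpace 𝒳]

theorem lintegral_setMeasure {α : Type*} [MeasurableSpace α] (ν : Measure α)
    {F : FinSet α → ℝ≥0∞} (hF : Measurable F) :
    ∫⁻ S, F S ∂(setMeasure ν) =
      ∑' N : ℕ, ((N ! : ℝ≥0∞))⁻¹ * ∫⁻ x, F (toSet x) ∂(Measure.pi fun _ : Fin N => ν) := by
  rw [setMeasure, lintegral_sum_measure]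
  refine tsum_congr fun N => ?_
  rw [lintegral_smul_measure, lintegral_map hF (measurable_toSet N), smul_eq_mul]

variable (μ : Measure 𝒳) [SigmaFinite μ]

open scoped Classical in
theorem lintegral_jointReference
    {F : FinSet (Fin (n + m + 1) × Traj k 𝒳) × (Fin m → Fin (n + m + 1)) → ℝ≥0∞}
    (hF : Measurable F) :
    ∫⁻ p, F p ∂(jointReference n m k μ) =
      ∑' N : ℕ, ((N ! : ℝ≥0∞))⁻¹ *
        ∑ β ∈ Finset.univ.filter (Admissible (n := n) (m := m)), ∑ v : Fin N → Fin (n + m + 1),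
          ∫⁻ X, F (toSet fun a => (v a, X a), β)
            ∂(Measure.pi fun _ : Fin N => trajMeasure k μ) := by
  have hFβ (β : Fin m → Fin (n + m + 1)) : Measurable fun S => F (S, β) :=
    hF.comp measurable_prodMk_right
  have hadm : MeasurableSet {β : Fin m → Fin (n + m + 1) | Admissible β} :=
    (Set.toFinite _).measurableSet
  rw [jointReference, lintegral_prod_symm _ hF.aemeasurable, ← lintegral_indicator hadm,
    lintegral_count, tsum_fintype]
  simp only [Set.indicator_apply, Set.mem_ofPred_eq]
  rw [← Finset.sum_filter]
  simp only [lintegral_setMeasure _ (hFβ _)]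
  rw [← Summable.tsum_finsetSum fun _ _ => ENNReal.summable]
  refine tsum_congr fun N => ?_
  rw [Finset.mul_sum]
  refine Finset.sum_congr rfl fun β _ => ?_
  rw [lintegral_pi_augMeasure μ N (F := fun x => F (toSet x, β))
    ((hFβ β).comp (measurable_toSet N))]

variable {μ} [NullSingletonClass μ] [MeasurableEq (Traj k 𝒳)]

/-- The unnormalized joint law has a density proportional to the product of the factors. -/
theorem jointMeasure_eq (P : PMB n k μ) (M : MeasModel d 𝒳)
    {z : Fin m → EuclideanSpace ℝ (Fin d)} (hz : Function.Injective z)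
    (hclutter : ∀ j, 0 < M.clutter (z j)) :
    jointMeasure P M z = (jointReference n m k μ).withDensity fun p =>
      ENNReal.ofReal (posteriorScale P M z * posteriorFactor P M z p.1 p.2) := by
  classical
  have hfac : Measurable fun p : FinSet (Fin (n + m + 1) × Traj k 𝒳) ×
      (Fin m → Fin (n + m + 1)) =>
      ENNReal.ofReal (posteriorScale P M z * posteriorFactor P M z p.1 p.2) :=
    (measurable_const.mul (measurable_from_prod_countable_left fun β =>
      measurable_posteriorFactor P M z β)).ennreal_ofReal
  refine Measure.ext fun A hA => ?_
  let h : FinSet (Fin (n + m + 1) × Traj k 𝒳) × (Fin m → Fin (n + m + 1)) → ℝ≥0∞ :=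
    A.indicator 1
  have hh : Measurable h := measurable_one.indicator hA
  have hfacA : Measurable fun p =>
      ENNReal.ofReal (posteriorScale P M z * posteriorFactor P M z p.1 p.2) * h p := hfac.mul hh
  have hdens {N : ℕ} (θ : Fin m → Option (Fin N)) :
      Measurable fun x : Fin N → Fin (n + 1) × Traj k 𝒳 =>
        ENNReal.ofReal (P.density (toSet x) * assocLik M z x θ) *
          h (toSet (updatedVec x θ), assocVec x θ) :=
    (((measurable_density P).comp (measurable_toSet N)).mul
      (measurable_assocLik M z θ)).ennreal_ofReal.mul (hh.comp (measurable_update n m k N θ))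
  have hlabel {c N : ℕ} (v : Fin N → Fin (c + 1)) :
      Measurable fun (X : Fin N → Traj k 𝒳) a => (v a, X a) := by fun_prop
  have hright : ((jointReference n m k μ).withDensity fun p =>
      ENNReal.ofReal (posteriorScale P M z * posteriorFactor P M z p.1 p.2)) A =
      ∫⁻ p, ENNReal.ofReal (posteriorScale P M z * posteriorFactor P M z p.1 p.2) * h p
        ∂(jointReference n m k μ) := by
    rw [withDensity_apply _ hA, ← lintegral_indicator hA]
    refine lintegral_congr fun p => ?_
    by_cases hp : p ∈ A <;> simp [h, hp]
  have hleft {N : ℕ} (θ : Fin m → Option (Fin N)) :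
      (((Measure.pi fun _ : Fin N => augMeasure n k μ).withDensity fun x =>
          ENNReal.ofReal (P.density (toSet x) * assocLik M z x θ)).map
        fun x => ((toSet (updatedVec x θ), assocVec x θ) :
          FinSet (Fin (n + m + 1) × Traj k 𝒳) × (Fin m → Fin (n + m + 1)))) A =
      ∑ u : Fin N → Fin (n + 1),
        ∫⁻ X, ENNReal.ofReal (P.density (toSet fun a => (u a, X a)) *
            assocLik M z (fun a => (u a, X a)) θ) *
          h (toSet (updatedVec (fun a => (u a, X a)) θ), assocVec (fun a => (u a, X a)) θ)
          ∂(Measure.pi fun _ : Fin N => trajMeasure k μ) := by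
    have hA' := measurable_update n m k N (𝒳 := 𝒳) θ hA
    rw [Measure.map_apply (measurable_update n m k N θ) hA, withDensity_apply _ hA',
      ← lintegral_indicator hA', ← lintegral_pi_augMeasure μ N (hdens θ)]
    refine lintegral_congr fun x => ?_
    by_cases hx : ((toSet (updatedVec x θ), assocVec x θ) :
      FinSet (Fin (n + m + 1) × Traj k 𝒳) × (Fin m → Fin (n + m + 1))) ∈ A <;>
      simp [h, hx]
  rw [hright, lintegral_jointReference μ hfacA, jointMeasure, Measure.sum_apply _ hA]
  refine tsum_congr fun N => ?_
  rw [Measure.smul_apply, Measure.finsetSum_apply, smul_eq_mul]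
  congr 1
  simp only [hleft]
  have hl (θ : Fin m → Option (Fin N)) (u : Fin N → Fin (n + 1)) := (hdens θ).comp (hlabel u)
  have hr (β : Fin m → Fin (n + m + 1)) (v : Fin N → Fin (n + m + 1)) :=
    hfacA.comp
      ((measurable_prodMk_right (y := β)).comp ((measurable_toSet N).comp (hlabel v)))
  simp only [Function.comp_def] at hl hr
  -- the trajectories are almost everywhere distinct, so that the factorization applies
  have hae := lintegral_congr_ae ((ae_injective_pi (trajMeasure k μ) N).mono fun X hX =>
    sum_origins_eq P M hz hclutter hX h)
  rw [lintegral_finsetSum _ fun θ _ => Finset.measurable_sum _ fun u _ => hl θ u,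
    lintegral_finsetSum _ fun β _ => Finset.measurable_sum _ fun v _ => hr β v] at hae
  simp only [lintegral_finsetSum _ fun u _ => hl _ u,
    lintegral_finsetSum _ fun v _ => hr _ v] at hae
  exact hae

end Joint

end TrajectoryPMB
end

open TrajectoryPMB in
theorem proposition3
    {d n m k : ℕ} {𝒳 : Type*} [TopologicalSpace 𝒳] [LocallyCompactSpace 𝒳] [T2Space 𝒳]
    [SecondCountableTopology 𝒳] [MeasurableSpace 𝒳] [BorelSpace 𝒳]
    (μ : Measure 𝒳) [SigmaFinite μ] [NullSingletonClass μ]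
    (P : PMB n k μ) (M : MeasModel d 𝒳)
    (z : Fin m → EuclideanSpace ℝ (Fin d)) (hz : Function.Injective z)
    (hclutter : ∀ j, 0 < M.clutter (z j))
    (hevidence : jointMeasure P M z Set.univ ≠ ∞) :
    ∃ C : ℝ, 0 < C ∧
      jointPosterior P M z = (jointReference n m k μ).withDensity fun p =>
        ENNReal.ofReal (C * (
          undetectedFactor P M (component p.1 0) *
          (∏ i : Fin n,
            (existingPrior P M i (exLabel m i) (component p.1 (exLabel m i)) *
              ∏ j : Fin m,
                sUnder M (exLabel m i) (component p.1 (exLabel m i)) (p.2 j) (z j))) *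
          ∏ i : Fin m,
            (newPrior P M (newLabel n i) (component p.1 (newLabel n i)) *
              sOver M (newLabel n i) (component p.1 (newLabel n i)) (p.2 i) (z i) *
              ∏ j ∈ Finset.Iio i,
                sUnder M (newLabel n i) (component p.1 (newLabel n i)) (p.2 j) (z j)))) := by
  have := measurableEq_traj k (𝒳 := 𝒳)
  have hscale := posteriorScale_pos P M hclutter
  have hjoint := jointMeasure_eq P M hz hclutter
  by_cases h0 : jointMeasure P M z Set.univ = 0
  · -- for evidence zero, both sides are the zero measure
    refine ⟨_, hscale, ?_⟩
    change _ = (jointReference n m k μ).withDensity fun p =>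
      ENNReal.ofReal (posteriorScale P M z * posteriorFactor P M z p.1 p.2)
    rw [← hjoint, jointPosterior, Measure.measure_univ_eq_zero.mp h0, smul_zero]
  · have hpos : 0 < (jointMeasure P M z Set.univ).toReal := ENNReal.toReal_pos h0 hevidence
    refine ⟨(jointMeasure P M z Set.univ).toReal⁻¹ * posteriorScale P M z,
      mul_pos (inv_pos.mpr hpos) hscale, ?_⟩
    change _ = (jointReference n m k μ).withDensity fun p =>
      ENNReal.ofReal ((jointMeasure P M z Set.univ).toReal⁻¹ * posteriorScale P M z *
        posteriorFactor P M z p.1 p.2)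
    have hinv : ENNReal.ofReal (jointMeasure P M z Set.univ).toReal⁻¹ =
        (jointMeasure P M z Set.univ)⁻¹ := by
      rw [ENNReal.ofReal_inv_of_pos hpos, ENNReal.ofReal_toReal hevidence]
    simp only [mul_assoc, ENNReal.ofReal_mul (inv_pos.mpr hpos).le, hinv]
    have hfin : (jointMeasure P M z Set.univ)⁻¹ ≠ ∞ := ENNReal.inv_ne_top.mpr h0
    rw [jointPosterior]
    generalize (jointMeasure P M z Set.univ)⁻¹ = c at hfin ⊢
    rw [hjoint, ← withDensity_smul' _ _ hfin]
    rfl
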